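/- Fix an integer $l\ge 1$; $[x]$ is the floor of $x$, $a_+=\max(a,0)$, and $0$ denotes the extra "zero" element of a crystal. **$\mathcal G^l$.** Let $\Lambda_1$ be the fundamental weight of $G_2$ whose representation is the adjoint one. The crystal $B(\Lambda_1)=\{1,\dots,6,0_1,0_2,\bar6,\dots,\bar1\}$ has the arrows $1\to_1 2$, $4\to_1 5$, $6\to_1 0_1\to_1\bar6$, $\bar5\to_1\bar4$, $\bar2\to_1\bar1$, $2\to_2 3\to_2 4\to_2 6$, $5\to_2 0_2\to_2\bar5$, $\bar6\to_2\bar4\to_2\bar3\to_2\bar2$. The row tableau $[x_1\cdots x_n]$ stands for $x_n\otimes\cdots\otimes x_1\in B(\Lambda_1)^{\otimes n}$ (Kashiwara's tensor product rule), $B^{G_2}(n\Lambda_1)$ is the connected component of $[1^n]$, and $\mathcal G^l=\bigoplus_{n=0}^l B^{G_2}(n\Lambda_1)$. Put $C_{\mathcal G}[x_1\cdots x_n]=[\bar x_n\cdots\bar x_1]$, with $\bar{\bar m}=m$ and $\bar 0_a=0_a$ ($a=1,2$). **$\mathcal A$.** Let $\mathcal A=\bigoplus_{0\le i\le[l/2]}\bigoplus_{i\le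 k,j\le l-i}B^i_{(k,j)}$, where $B^i_{(k,j)}$ is a copy of the crystal of type $A_2$ (index set $\{1,0\}$) with highest weight $k\Lambda_1+j\Lambda_0$ and highest weight element $h^{i}_{(k,j)}=h^{l,i}_{(k,j)}$; its elements are uniquely $\tilde f_0^r\tilde f_1^q\tilde f_0^p h^i_{(k,j)}$ with $0\le p\le j$, $p\le q\le p+k$, $0\le r\le j+q-2p$. Put $$C_{\mathcal A}(\tilde f_0^r\tilde f_1^q\tilde f_0^p h^i_{(k,j)})=\tilde f_0^{j+q-2p-r}\tilde f_1^{k+j-q}\tilde f_0^{k-q+p}h^i_{(j,k)} .$$ Let $\mathcal A^{(l)}\subset\mathcal A$ consist of all elements of $B^i_{(k,j)}$ with $k=i$ or $j=i$ and, for $i<k,j\le l-i$, of the elements $\tilde f_1^q\tilde f_0^ph^i_{(k,j)}$ ($0\le p\le j$, $0\le q\le p+k$) and $\tilde e_1^q\tilde e_0^p$ of the lowest weight element of $B^i_{(k,j)}$ ($0\le p<k$, $0\le q\le p+j$). The complement of $\mathcal A^{(l)}$ is identified with the set $\mathcal A$ for $l-1$ by letting $\tilde f_0^{r}\tilde f_1^{q}\tilde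 f_0^ph^{l-1,i}_{(k,j)}$ be $\tilde f_0^{r+1}\tilde f_1^{q+1}\tilde f_0^ph^{l,i}_{(k+1,j+1)}$. **$E_{\mathcal A}$.** $E_{\mathcal A}:\mathcal A\to\mathcal A\sqcup\{0\}$ satisfies $E_{\mathcal A}\tilde f_0^r b=\tilde f_0^rE_{\mathcal A}b$ for $\tilde e_0b=0$, and on $b=\tilde f_1^q\tilde f_0^ph^i_{(k,j)}$ ($0\le p\le j$, $p\le q\le p+k$) it is given as follows. Write $e_1=\tilde f_1^q\tilde f_0^ph^i_{(k-1,j)}$; $e_2=\tilde f_1^{q+1}\tilde f_0^{p+1}h^i_{(k,j+1)}$ if $j<l-i$ and $e_2=0$ if $j=l-i$; and $e_3,e_4,e_5=\tilde f_1^{q+1}\tilde f_0^ph^{i'}_{(k+1,j-1)}$ with $i'=i+1,i,i-1$ respectively. (1) $k,j>i$: if $p=\min(q,j)$, then $E_{\mathcal A}b=e_1$ when $q\le j-1-[\frac{j-k}3]$ and $e_2$ otherwise; if $p\ne\min(q,j)$, then $E_{\mathcal A}b=\tilde e_0E_{\mathcal A}(\tilde f_1^{q-1}\tilde f_0^ph^{l-1,i}_{(k-1,j-1)})$,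 the inner $E_{\mathcal A}$ being that for $l-1$ (and $E_{\mathcal A}=0$ for $l=0$). (2) $k=i$, $j\ge i+2$: $e_3$ if $p\le j-1-[\frac{j-i}3]$, else $e_2$. (3) $k=i$, $j=i+1$: $e_4$ if $p\le i$, else $e_2$. (4) $k=j=i$: $e_5$ if $p\le i-1$, else $e_2$. (5) $k>i$, $j=i$: $e_1$ if $q\le p-1-[\frac{i-k}3]$; otherwise $e_2$ if $p=i$ and $e_5$ if $p<i$. **$\Phi$.** For $0\le i\le[l/2]$, $i\le j\le l-i$ put $h_{i,j}=h^{l,i}_{(l-i,j)}$, $y=[\frac{l-i-j}3]$. Let $\mathcal C^m$ be the row $6^{m/2}\bar6^{m/2}$ ($m$ even) or $6^{(m-1)/2}0_1\bar6^{(m-1)/2}$ ($m$ odd). With the three lines for $l-i-j\equiv0,1,2\pmod 3$, $\Phi(\tilde f_0^ph_{i,j})$ is, for $0\le p\le i$, $$\begin{array}{l}[1^p6^y\mathcal C^{y+i-p}\bar2^{y+j}],\\ [1^p6^{y+1}\mathcal C^{y+i-p-1}\bar4\,\bar2^{y+j}]\ (p<y+i),\quad[1^i\bar5\,\bar2^{j}]\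 (p=y+i),\\ [1^p6^{y+1}\mathcal C^{y+i-p}\bar3\,\bar2^{y+j}],\end{array}$$ and, for $i<p\le j$, $$\begin{array}{l}[1^i6^{p-i+y}\mathcal C^{y}\bar2^{y+j-p+i}],\\ [1^i6^{p-i+y+1}\mathcal C^{y-1}\bar4\,\bar2^{y+j-p+i}]\ (y>0),\quad[1^i6^{p-i}\bar5\,\bar2^{j-p+i}]\ (y=0),\\ [1^i6^{p-i+y+1}\mathcal C^{y}\bar3\,\bar2^{y+j-p+i}].\end{array}$$ Consider the elements $t=\tilde f_1^q\tilde f_0^ph_{i,j}$ with $0\le p\le j$, and let $B_C$: $0\le q\le p$; $B_R$: $i<j$, $p<j$, $p<q\le y+j-(i-p)_+$; $B_W$: $j=i$, $p<q\le y+j$; $B_U$: $p=j$, $j<q\le y+2j-i$. On $B_C\cup B_R$ put $\Phi(\tilde f_1^q\tilde f_0^ph_{i,j})=\tilde f_1^q\,\Phi(\tilde f_0^ph_{i,j})$, and then $\Phi(E_{\mathcal A}^mt)=\tilde e_2^m\Phi(t)$ whenever $t\in B_C\cup B_R$ and $E_{\mathcal A}^mt\ne0$. For a remaining $b\in\mathcal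 A^{(l)}$ of the form $E_{\mathcal A}^m\tilde f_0^rt$ with $t\in B_W\cup B_U$, or $E_{\mathcal A}^m\tilde f_0^{\varphi_0(t)}t$ with $t\in B_R$, put $\Phi(b)=C_{\mathcal G}(\Phi(C_{\mathcal A}b))$, where $\Phi(C_{\mathcal A}b)$ is given by the preceding rule. Outside $\mathcal A^{(l)}$, $\Phi$ is the map $\Phi$ for $l-1$ under the above identification. **Proposition.** For every $b\in\mathcal A^{(l)}$, $\Phi(b)$ and $\Phi(C_{\mathcal A}b)$ are defined, $\Phi(b)\in\mathcal G^l$, and $$C_{\mathcal G}(\Phi(b))=\Phi(C_{\mathcal A}(b)).$$ -/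

import Mathlib

/-! Partial maps `α → α ⊔ {0}` are maps `α → Option α`, with `none` in the role of `0`. -/

namespace G2Crystal

/-- The `n`-th power of a partial operator, applied to an element of `α ⊔ {0}`. -/
def iter {α : Type} (g : α → Option α) (n : ℕ) (x : Option α) : Option α :=
  (fun o => o.bind g)^[n] x

/-! ### The `G₂`-crystals `B(nΛ₁)` and the set `𝒢^l`

`Λ₁` is the fundamental weight whose representation is the adjoint one
(`α₁` is the long simple root, `α₂` the short one). -/

/-- The index set `{1, 2}` of the simple roots of `G₂`. -/
inductive Idx : Type
  | i1
  | i2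

/-- The 14 elements `1, …, 6, 0₁, 0₂, 6̄, …, 1̄` of the crystal `B(Λ₁)`. -/
inductive Letter : Type
  | n1 | n2 | n3 | n4 | n5 | n6
  | z1 | z2
  | b6 | b5 | b4 | b3 | b2 | b1

open Idx Letter

/-- The crystal graph of the adjoint representation:
`1 →₁ 2`, `4 →₁ 5`, `6 →₁ 0₁ →₁ 6̄`, `5̄ →₁ 4̄`, `2̄ →₁ 1̄`,
`2 →₂ 3 →₂ 4 →₂ 6`, `5 →₂ 0₂ →₂ 5̄`, `6̄ →₂ 4̄ →₂ 3̄ →₂ 2̄`. -/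
def letterF : Idx → Letter → Option Letter
  | i1, n1 => some n2
  | i1, n4 => some n5
  | i1, n6 => some z1
  | i1, z1 => some b6
  | i1, b5 => some b4
  | i1, b2 => some b1
  | i2, n2 => some n3
  | i2, n3 => some n4
  | i2, n4 => some n6
  | i2, n5 => some z2
  | i2, z2 => some b5
  | i2, b6 => some b4
  | i2, b4 => some b3
  | i2, b3 => some b2
  | _, _ => none

/-- The arrows of the crystal graph reversed. -/
def letterE : Idx → Letter → Option Letter
  | i1, n2 => some n1
  | i1, n5 => some n4
  | i1, z1 => some n6
  | i1, b6 => some z1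
  | i1, b4 => some b5
  | i1, b1 => some b2
  | i2, n3 => some n2
  | i2, n4 => some n3
  | i2, n6 => some n4
  | i2, z2 => some n5
  | i2, b5 => some z2
  | i2, b4 => some b6
  | i2, b3 => some b4
  | i2, b2 => some b3
  | _, _ => none

/-- `ε_i(x) = max {n | ẽ_i^n x ≠ 0}`. -/
def letterEps : Idx → Letter → ℕ
  | i1, n2 => 1
  | i1, n5 => 1
  | i1, z1 => 1
  | i1, b6 => 2
  | i1, b4 => 1
  | i1, b1 => 1
  | i2, n3 => 1
  | i2, n4 => 2
  | i2, n6 => 3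
  | i2, z2 => 1
  | i2, b5 => 2
  | i2, b4 => 1
  | i2, b3 => 2
  | i2, b2 => 3
  | _, _ => 0

/-- `φ_i(x) = max {n | f̃_i^n x ≠ 0}`. -/
def letterPhi : Idx → Letter → ℕ
  | i1, n1 => 1
  | i1, n4 => 1
  | i1, n6 => 2
  | i1, z1 => 1
  | i1, b5 => 1
  | i1, b2 => 1
  | i2, n2 => 3
  | i2, n3 => 2
  | i2, n4 => 1
  | i2, n5 => 2
  | i2, z2 => 1
  | i2, b6 => 3
  | i2, b4 => 2
  | i2, b3 => 1
  | _, _ => 0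

/-- A one-row tableau `[x₁ x₂ … xₙ]`; it stands for `xₙ ⊗ ⋯ ⊗ x₂ ⊗ x₁ ∈ B(Λ₁)^{⊗ n}`. -/
abbrev Word : Type := List Letter

mutual
/-- `ε_i` on `B(Λ₁)^{⊗ n}`: `ε_i(b ⊗ b') = ε_i(b) + max(0, ε_i(b') - φ_i(b))`. -/
def wordEps (a : Idx) : Word → ℕ
  | [] => 0
  | x :: w => wordEps a w + (letterEps a x - wordPhi a w)
/-- `φ_i` on `B(Λ₁)^{⊗ n}`: `φ_i(b ⊗ b') = φ_i(b') + max(0, φ_i(b) - ε_i(b'))`. -/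
def wordPhi (a : Idx) : Word → ℕ
  | [] => 0
  | x :: w => letterPhi a x + (wordPhi a w - letterEps a x)
end

/-- `f̃_i(b ⊗ b')` is `f̃_i b ⊗ b'` if `φ_i(b) > ε_i(b')` and `b ⊗ f̃_i b'` otherwise. -/
def wordF (a : Idx) : Word → Option Word
  | [] => none
  | x :: w =>
    if letterEps a x < wordPhi a w then (wordF a w).map (fun w' => x :: w')
    else (letterF a x).map (fun x' => x' :: w)

/-- `ẽ_i(b ⊗ b')` is `ẽ_i b ⊗ b'` if `φ_i(b) ≥ ε_i(b')` and `b ⊗ ẽ_i b'` otherwise. -/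
def wordE (a : Idx) : Word → Option Word
  | [] => none
  | x :: w =>
    if letterEps a x ≤ wordPhi a w then (wordE a w).map (fun w' => x :: w')
    else (letterE a x).map (fun x' => x' :: w)

/-- `B^{G₂}(nΛ₁)`: the connected component of the highest weight element `[1 1 … 1]` in
`B(Λ₁)^{⊗ n}`. -/
def BG2 (n : ℕ) : Set Word :=
  {w | Relation.ReflTransGen
    (fun u v => ∃ a : Idx, wordF a u = some v ∨ wordE a u = some v)
    (List.replicate n n1) w}

/-- `𝒢^l = ⊕_{n=0}^l B^{G₂}(nΛ₁)`; the summands are disjoint since `B^{G₂}(nΛ₁)` consists of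
words of length `n`. -/
def calG (l : ℕ) : Set Word := {w | ∃ n ≤ l, w ∈ BG2 n}

/-- The bar on letters: it exchanges `m` and `m̄` and fixes `0₁` and `0₂`. -/
def barLetter : Letter → Letter
  | n1 => b1
  | n2 => b2
  | n3 => b3
  | n4 => b4
  | n5 => b5
  | n6 => b6
  | z1 => z1
  | z2 => z2
  | b6 => n6
  | b5 => n5
  | b4 => n4
  | b3 => n3
  | b2 => n2
  | b1 => n1

/-- The involution `C_𝒢 [x₁ … xₙ] = [x̄ₙ … x̄₁]`. -/
def CG (w : Word) : Word := (w.map barLetter).reverse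

/-! ### The `A₂`-crystal `𝒜` -/

/-- The coordinates of `f̃₀^r f̃₁^q f̃₀^p h`, where `h` is the highest weight element of
weight `kΛ₁ + jΛ₀` in the copy `B^i_{(k,j)}` of `B^{A₂}(kΛ₁ + jΛ₀)`. -/
@[ext] structure AElt : Type where
  i : ℕ
  k : ℕ
  j : ℕ
  p : ℕ
  q : ℕ
  r : ℕ

/-- `𝒜 = ⊕_{0 ≤ i ≤ [l/2]} ⊕_{i ≤ k, j ≤ l - i} B^i_{(k,j)}`, where every element of
`B^i_{(k,j)}` is uniquely `f̃₀^r f̃₁^q f̃₀^p h` with `0 ≤ p ≤ j`, `p ≤ q ≤ p + k`,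
`0 ≤ r ≤ j + q - 2p`. -/
def calA (l : ℕ) : Set AElt :=
  {b | 2 * b.i ≤ l ∧ b.i ≤ b.k ∧ b.i + b.k ≤ l ∧ b.i ≤ b.j ∧ b.i + b.j ≤ l ∧
    b.p ≤ b.j ∧ b.p ≤ b.q ∧ b.q ≤ b.p + b.k ∧ b.r + 2 * b.p ≤ b.j + b.q}

/-- `φ₀`. -/
def phi0A (b : AElt) : ℕ := b.j + b.q - (2 * b.p + b.r)

/-- `f̃₀`. -/
def f0A (b : AElt) : Option AElt :=
  if b.r + 2 * b.p < b.j + b.q then some { b with r := b.r + 1 } else none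

/-- `ẽ₀`. -/
def e0A (b : AElt) : Option AElt :=
  if 0 < b.r then some { b with r := b.r - 1 } else none

/-- `f̃₁`: here `φ₁ = k + p + r - 2q + max(p, q - r)`. -/
def f1A (b : AElt) : Option AElt :=
  if b.r + b.p ≤ b.q then
    if b.q < b.k + b.p then some { b with q := b.q + 1 } else none
  else
    if 2 * b.q < b.k + 2 * b.p + b.r then
      some { b with p := b.p + 1, q := b.q + 1, r := b.r - 1 }
    else none

/-- `ẽ₁`: here `ε₁ = max(p, q - r)`. -/
def e1A (b : AElt) : Option AElt :=
  if b.r + b.p < b.q then some { b with q := b.q - 1 }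
  else if 0 < b.p then some { b with p := b.p - 1, q := b.q - 1, r := b.r + 1 }
  else none

/-- The highest weight element of `B^i_{(k,j)}`. -/
def hw (i k j : ℕ) : AElt := ⟨i, k, j, 0, 0, 0⟩

/-- The lowest weight element of `B^i_{(k,j)}`, of weight `-jΛ₁ - kΛ₀`; it is
`f̃₀^k f̃₁^{k+j} f̃₀^j` of the highest weight element. -/
def lw (i k j : ℕ) : AElt := ⟨i, k, j, j, k + j, k⟩

/-- `f̃₁^q f̃₀^p` of the highest weight element of `B^i_{(k,j)}`. -/
def f1f0 (i k j p q : ℕ) : Option AElt := iter f1A q (iter f0A p (some (hw i k j)))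

/-- `𝒜^{(l)}`: the union of the `B^i_{(k,i)}`, the `B^i_{(i,j)}`, and, for `i < k, j ≤ l - i`,
of the elements `f̃₁^q f̃₀^p` of the highest (`0 ≤ p ≤ j`, `0 ≤ q ≤ p + k`) and `ẽ₁^q ẽ₀^p` of the
lowest weight element (`0 ≤ p < k`, `0 ≤ q ≤ p + j`) of `B^i_{(k,j)}`. -/
def calAl (l : ℕ) : Set AElt :=
  {b | b ∈ calA l ∧
    (b.j = b.i ∨ b.k = b.i ∨
      (∃ p q : ℕ, p ≤ b.j ∧ q ≤ p + b.k ∧ f1f0 b.i b.k b.j p q = some b) ∨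
      (∃ p q : ℕ, p < b.k ∧ q ≤ p + b.j ∧
        iter e1A q (iter e0A p (some (lw b.i b.k b.j))) = some b))}

/-- The identification of the set `𝒜` of level `l - 1` with the complement of `𝒜^{(l)}` in the
set `𝒜` of level `l`: `f̃₀^r f̃₁^q f̃₀^p h^{l-1,i}_{(k,j)}` is
`f̃₀^{r+1} f̃₁^{q+1} f̃₀^p h^{l,i}_{(k+1,j+1)}`. -/
def raise (b : AElt) : AElt := ⟨b.i, b.k + 1, b.j + 1, b.p, b.q + 1, b.r + 1⟩

/-- The inverse of `raise`. -/
def lower (b : AElt) : AElt := ⟨b.i, b.k - 1, b.j - 1, b.p, b.q - 1, b.r - 1⟩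

/-- `EAHigh l i k j p q` is `E_𝒜 (f̃₁^q f̃₀^p h)`, `h` the highest weight element of `B^i_{(k,j)}`
and `p ≤ q`; `/` on `ℤ` with divisor `3` is the floor `[·/3]`. In every branch that raises `j`
the value is `0` when `j = l - i`. -/
def EAHigh : ℕ → ℕ → ℕ → ℕ → ℕ → ℕ → Option AElt
  | 0, _, _, _, _, _ => none
  | l + 1, i, k, j, p, q =>
    if i < k ∧ i < j then
      if p = min q j then
        if (q : ℤ) ≤ j - 1 - ((j : ℤ) - k) / 3 then some ⟨i, k - 1, j, p, q, 0⟩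
        else if i + j < l + 1 then some ⟨i, k, j + 1, p + 1, q + 1, 0⟩
        else none
      else (EAHigh l i (k - 1) (j - 1) p (q - 1)).bind (fun b => e0A (raise b))
    else if k = i then
      if i + 2 ≤ j then
        if (p : ℤ) ≤ j - 1 - ((j : ℤ) - i) / 3 then some ⟨i + 1, k + 1, j - 1, p, q + 1, 0⟩
        else if i + j < l + 1 then some ⟨i, k, j + 1, p + 1, q + 1, 0⟩
        else none
      else if j = i + 1 then
        if p ≤ i then some ⟨i, k + 1, j - 1, p, q + 1, 0⟩
        else if i + j < l + 1 then some ⟨i, k, j + 1, p + 1, q + 1, 0⟩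
        else none
      else
        if p < i then some ⟨i - 1, k + 1, j - 1, p, q + 1, 0⟩
        else if i + j < l + 1 then some ⟨i, k, j + 1, p + 1, q + 1, 0⟩
        else none
    else
      if (q : ℤ) ≤ p - 1 - ((i : ℤ) - k) / 3 then some ⟨i, k - 1, j, p, q, 0⟩
      else if p = i then some ⟨i, k, j + 1, p + 1, q + 1, 0⟩
      else some ⟨i - 1, k + 1, j - 1, p, q + 1, 0⟩

/-- The operator `E_𝒜`, extended from the kernel of `ẽ₀` by `E_𝒜 f̃₀ = f̃₀ E_𝒜`. -/
def EA (l : ℕ) (b : AElt) : Option AElt := iter f0A b.r (EAHigh l b.i b.k b.j b.p b.q)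

/-- The involution
`C_𝒜 (f̃₀^r f̃₁^q f̃₀^p h_{(k,j)}) = f̃₀^{j+q-2p-r} f̃₁^{k+j-q} f̃₀^{k-q+p} h_{(j,k)}`
(on `𝒜` all the subtractions are those of `ℤ`). -/
def CA (b : AElt) : AElt :=
  ⟨b.i, b.j, b.k, b.k + b.p - b.q, b.k + b.j - b.q, b.j + b.q - (2 * b.p + b.r)⟩

/-! ### The map `Φ` -/

/-- `y = [(l - i - j)/3]`. -/
def yy (l i j : ℕ) : ℕ := (l - i - j) / 3

/-- `f̃₁^q f̃₀^p h^{l,i}_{(l-i,j)}` with `0 ≤ q ≤ p ≤ j`. -/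
def BC (l : ℕ) : Set AElt :=
  {b | ∃ i j p q : ℕ, 2 * i ≤ l ∧ i ≤ j ∧ i + j ≤ l ∧ q ≤ p ∧ p ≤ j ∧
    f1f0 i (l - i) j p q = some b}

/-- `f̃₁^q f̃₀^p h^{l,i}_{(l-i,i)}` with `p ≤ i`, `p < q ≤ y + i`. -/
def BW (l : ℕ) : Set AElt :=
  {b | ∃ i p q : ℕ, 2 * i ≤ l ∧ p ≤ i ∧ p < q ∧ q ≤ yy l i i + i ∧
    f1f0 i (l - i) i p q = some b}

/-- `f̃₁^q f̃₀^j h^{l,i}_{(l-i,j)}` with `j < q ≤ y + 2j - i`. -/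
def BU (l : ℕ) : Set AElt :=
  {b | ∃ i j q : ℕ, 2 * i ≤ l ∧ i ≤ j ∧ i + j ≤ l ∧ j < q ∧ q ≤ yy l i j + 2 * j - i ∧
    f1f0 i (l - i) j j q = some b}

/-- `f̃₁^q f̃₀^p h^{l,i}_{(l-i,j)}` with `i < j`, `p < j`, `p < q ≤ y + j - (i - p)_+`. -/
def BR (l : ℕ) : Set AElt :=
  {b | ∃ i j p q : ℕ, 2 * i ≤ l ∧ i < j ∧ i + j ≤ l ∧ p < j ∧ p < q ∧
    q ≤ yy l i j + j - (i - p) ∧ f1f0 i (l - i) j p q = some b}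

/-- A block of `m` equal boxes. -/
def box (x : Letter) (m : ℕ) : Word := List.replicate m x

/-- The block `𝒞^m` of `m` boxes of total weight `0`: `6 ⋯ 6 6̄ ⋯ 6̄` for even `m` and
`6 ⋯ 6 0₁ 6̄ ⋯ 6̄` for odd `m`. -/
def blockC (m : ℕ) : Word := box n6 (m / 2) ++ box z1 (m % 2) ++ box b6 (m / 2)

/-- The tableau `Φ(f̃₀^p h^{l,i}_{(l-i,j)})`, `0 ≤ p ≤ j`. -/
def PhiTop (l i j p : ℕ) : Word :=
  let y := yy l i j
  if p ≤ i then
    if (l - i - j) % 3 = 0 then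
      box n1 p ++ box n6 y ++ blockC (y + i - p) ++ box b2 (y + j)
    else if (l - i - j) % 3 = 1 then
      if p < y + i then
        box n1 p ++ box n6 (y + 1) ++ blockC (y + i - p - 1) ++ box b4 1 ++ box b2 (y + j)
      else box n1 i ++ box b5 1 ++ box b2 j
    else box n1 p ++ box n6 (y + 1) ++ blockC (y + i - p) ++ box b3 1 ++ box b2 (y + j)
  else
    if (l - i - j) % 3 = 0 then
      box n1 i ++ box n6 (p - i + y) ++ blockC y ++ box b2 (y + j + i - p)
    else if (l - i - j) % 3 = 1 then
      if 0 < y then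
        box n1 i ++ box n6 (p - i + y + 1) ++ blockC (y - 1) ++ box b4 1 ++
          box b2 (y + j + i - p)
      else box n1 i ++ box n6 (p - i) ++ box b5 1 ++ box b2 (j + i - p)
    else box n1 i ++ box n6 (p - i + y + 1) ++ blockC y ++ box b3 1 ++ box b2 (y + j + i - p)

/-- `Φ(t) = u` by the rule `Φ(f̃₁^q f̃₀^p h^{l,i}_{(l-i,j)}) = f̃₁^q Φ(f̃₀^p h^{l,i}_{(l-i,j)})`,
`0 ≤ p ≤ j`, `0 ≤ q ≤ y + j - (i - p)_+`. -/
def PhiStart (l : ℕ) (t : AElt) (u : Word) : Prop :=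
  ∃ i j p q : ℕ, 2 * i ≤ l ∧ i ≤ j ∧ i + j ≤ l ∧ p ≤ j ∧ q ≤ yy l i j + j - (i - p) ∧
    f1f0 i (l - i) j p q = some t ∧ iter (wordF i1) q (some (PhiTop l i j p)) = some u

/-- `Φ(b) = w` by the rule `Φ(E_𝒜^m t) = ẽ₂^m Φ(t)` for `t ∈ B_C ∪ B_R`. -/
def PhiString (l : ℕ) (b : AElt) (w : Word) : Prop :=
  ∃ t ∈ BC l ∪ BR l, ∃ (u : Word) (m : ℕ), PhiStart l t u ∧
    iter (EA l) m (some t) = some b ∧ iter (wordE i2) m (some u) = some w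

open Classical in
/-- `Φ` on the `E_𝒜`-strings that start in `B_C ∪ B_R` (`none` elsewhere). -/
noncomputable def PhiCR (l : ℕ) (b : AElt) : Option Word :=
  if h : ∃ w, PhiString l b w then some h.choose else none

/-- The elements on the `E_𝒜`-strings that start in `B_C ∪ B_R`. -/
def strCR (l : ℕ) : Set AElt :=
  {b | ∃ t ∈ BC l ∪ BR l, ∃ m : ℕ, iter (EA l) m (some t) = some b}

/-- The elements `E_𝒜^m f̃₀^r t` with `t ∈ B_W ∪ B_U`. -/
def strWU (l : ℕ) : Set AElt :=
  {b | ∃ t ∈ BW l ∪ BU l, ∃ r m : ℕ, iter (EA l) m (iter f0A r (some t)) = some b}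

/-- The elements `E_𝒜^m f̃₀^{φ₀(t)} t` with `t ∈ B_R`. -/
def strR (l : ℕ) : Set AElt :=
  {b | ∃ t ∈ BR l, ∃ m : ℕ, iter (EA l) m (iter f0A (phi0A t) (some t)) = some b}

open Classical in
/-- `Φ` on `𝒜^{(l)}`: by `Φ(E_𝒜^m t) = ẽ₂^m Φ(t)` on the strings from `B_C ∪ B_R`, and by
`Φ(b) = C_𝒢 Φ(C_𝒜 b)` on the strings from the `f̃₀`-strings through `B_W ∪ B_U` and from the
lower ends of the `f̃₀`-strings through `B_R`. -/
noncomputable def PhiLevel (l : ℕ) (b : AElt) : Option Word :=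
  if b ∈ strCR l then PhiCR l b
  else if b ∈ strWU l ∪ strR l then (PhiCR l (CA b)).map CG
  else none

open Classical in
/-- The map `Φ : 𝒜 → 𝒢^l`; an element outside `𝒜^{(l)}` belongs to the set `𝒜` of level
`l - 1`. -/
noncomputable def Phi : ℕ → AElt → Option Word
  | 0, b => PhiLevel 0 b
  | l + 1, b => if b ∈ calAl (l + 1) then PhiLevel (l + 1) b else Phi l (lower b)

end G2Crystal

/-!
Both `E_𝒜` and `C_𝒜` become elementary in the coordinates `(i, k, j, p, q, r)`. The recursion for
`E_𝒜` only serves to pass from level `l - 1` to level `l` (`EAHigh_lift`), so everything reduces to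
the *reduced* elements, those with `k = i`, `j = i`, `q = p` or `p = j`, on which `E_𝒜` is the
explicit operator `redE`. There `C_𝒜` reverses the arrows of `E_𝒜` (`redE_CA`), and it maps the end
of a string to an element satisfying `IsStart` (`redE_none`). Following the string of `C_𝒜 b` to its
end therefore produces the start of the string of `b`; the starts with `q = p` form `B_C`, the
non-reduced ones `B_R`, and the others lie in `B_W ∪ B_U`. A string which starts in the last set
stays in the set `p = j` or `j = i` and so ends in `C_𝒜 B_C`. Hence an element of `𝒜^{(l)}` outside
the strings from `B_C ∪ B_R` is sent to such a string by `C_𝒜` (`cover_of_notMem_strCR`), and the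
claim holds for it by the definition of `Φ`. What is left is that `Φ` is
defined, with values in `𝒢^l`, on the strings from `B_C ∪ B_R`, and that the identity holds if both
`b` and `C_𝒜 b` lie on such strings.

In the latter case both strings start in `B_C`, and following the string from `(i, j, q)` to its
end shows that the other one starts at `(q, i + j - q, i)`, or at the same point if `q = j`
(`string_between_BC`). On the side of tableaux, `f̃₁^q Φ(f̃₀^p h)` is a row of blocks, whose shape
is preserved by passing to the highest element of its `2`-string and applying `C_𝒢`
(`iter_wordE_i2_row`). Comparison of the parameters gives the identity at the ends of the strings
(`iter_wordE_PhiTop_eq_CG`), and it spreads along them because `C_𝒢` exchanges `ẽ_a` and `f̃_a`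
(`wordF_CG`). The `2`-string through `f̃₁^q Φ(f̃₀^p h)` has `2(l - i) + j - 3q` arrows above it, and
the string of `E_𝒜` is not longer (`length_string_le`), so that `Φ` is defined.

The rows lie in `B^{G₂}(nΛ₁)` because they are standard: read as sequences of
Lakshmibai–Seshadri paths, their directions increase. Standard rows are stable under `ẽ_a`, and
`[1 ⋯ 1]` is the only one of highest weight (`Standard.mem_BG2`).
-/

namespace G2Crystal

open Idx Letter

/-! ### Powers of partial operators -/

section Iter

variable {α β : Type}

@[simp] lemma iter_zero (g : α → Option α) (x : Option α) : iter g 0 x = x := rfl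

lemma iter_succ (g : α → Option α) (n : ℕ) (x : Option α) :
    iter g (n + 1) x = iter g n (x.bind g) := rfl

lemma iter_succ' (g : α → Option α) (n : ℕ) (x : Option α) :
    iter g (n + 1) x = (iter g n x).bind g :=
  Function.iterate_succ_apply' _ _ _

lemma iter_add (g : α → Option α) (m n : ℕ) (x : Option α) :
    iter g (m + n) x = iter g n (iter g m x) := by
  rw [Nat.add_comm]
  exact Function.iterate_add_apply _ _ _ _

@[simp] lemma iter_none (g : α → Option α) (n : ℕ) : iter g n none = none := by
  induction n with
  | zero => rfl
  | succ n ih => rw [iter_succ]; exact ih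

lemma iter_succ_eq_some {g : α → Option α} {n : ℕ} {x z : α} :
    iter g (n + 1) (some x) = some z ↔ ∃ y, g x = some y ∧ iter g n (some y) = some z := by
  rw [iter_succ, Option.bind_some]
  cases h : g x <;> simp

lemma iter_succ_eq_some' {g : α → Option α} {n : ℕ} {x z : α} :
    iter g (n + 1) (some x) = some z ↔ ∃ y, iter g n (some x) = some y ∧ g y = some z := by
  rw [iter_succ']
  cases h : iter g n (some x) <;> simp

/-- A shorter power is defined whenever a longer one is. -/
lemma exists_iter_of_le {g : α → Option α} {m n : ℕ} {x z : α} (hmn : m ≤ n)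
    (h : iter g n (some x) = some z) :
    ∃ y, iter g m (some x) = some y ∧ iter g (n - m) (some y) = some z := by
  obtain ⟨d, rfl⟩ := Nat.exists_eq_add_of_le hmn
  rw [iter_add] at h
  cases hy : iter g m (some x) with
  | none => simp [hy] at h
  | some y => exact ⟨y, rfl, by rw [Nat.add_sub_cancel_left, ← hy]; exact h⟩

/-- A property preserved by a partial operator is preserved by its powers. -/
lemma iter_invariant {g : α → Option α} (P : α → Prop)
    (hP : ∀ x y, P x → g x = some y → P y) (n : ℕ) {x z : α} (hx : P x)
    (h : iter g n (some x) = some z) : P z := by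
  induction n generalizing x with
  | zero => simp only [iter_zero, Option.some.injEq] at h; exact h ▸ hx
  | succ n ih =>
    obtain ⟨y, hy, hz⟩ := iter_succ_eq_some.1 h
    exact ih (hP x y hx hy) hz

/-- If `c` turns each arrow `x → y` of `g` in a `g`-stable set into an arrow `c y → c x` of `g'`,
it turns paths into reversed paths. -/
lemma iter_reverse {g : α → Option α} {g' : β → Option β} (c : α → β) (P : α → Prop)
    (hP : ∀ x y, P x → g x = some y → P y)
    (hc : ∀ x y, P x → g x = some y → g' (c y) = some (c x)) (n : ℕ) {x z : α} (hx : P x)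
    (h : iter g n (some x) = some z) : iter g' n (some (c z)) = some (c x) := by
  induction n generalizing x with
  | zero => simp only [iter_zero, Option.some.injEq] at h ⊢; rw [h]
  | succ n ih =>
    obtain ⟨y, hy, hz⟩ := iter_succ_eq_some.1 h
    exact iter_succ_eq_some'.2 ⟨c y, ih (hP x y hx hy) hz, hc x y hx hy⟩

end Iter

/-! ### The tensor product rule on words -/

lemma letterE_some {a : Idx} {x y : Letter} (h : letterE a x = some y) :
    letterF a y = some x ∧ letterEps a x = letterEps a y + 1 ∧
      letterPhi a y = letterPhi a x + 1 := by
  cases a <;> cases x <;> simp_all [letterE] <;> subst h <;> exact ⟨rfl, rfl, rfl⟩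

lemma letterF_some {a : Idx} {x y : Letter} (h : letterF a x = some y) :
    letterE a y = some x ∧ letterEps a y = letterEps a x + 1 ∧
      letterPhi a x = letterPhi a y + 1 := by
  cases a <;> cases x <;> simp_all [letterF] <;> subst h <;> exact ⟨rfl, rfl, rfl⟩

lemma letterE_none {a : Idx} {x : Letter} (h : letterE a x = none) : letterEps a x = 0 := by
  cases a <;> cases x <;> simp_all [letterE, letterEps]

lemma letterF_none {a : Idx} {x : Letter} (h : letterF a x = none) : letterPhi a x = 0 := by
  cases a <;> cases x <;> simp_all [letterF, letterPhi]

@[simp] lemma wordEps_nil (a : Idx) : wordEps a [] = 0 := by rw [wordEps]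

@[simp] lemma wordPhi_nil (a : Idx) : wordPhi a [] = 0 := by rw [wordPhi]

lemma wordEps_cons (a : Idx) (x : Letter) (w : Word) :
    wordEps a (x :: w) = wordEps a w + (letterEps a x - wordPhi a w) := by rw [wordEps]

lemma wordPhi_cons (a : Idx) (x : Letter) (w : Word) :
    wordPhi a (x :: w) = letterPhi a x + (wordPhi a w - letterEps a x) := by rw [wordPhi]

lemma wordE_some {a : Idx} {w v : Word} (h : wordE a w = some v) :
    wordF a v = some w ∧ wordEps a w = wordEps a v + 1 ∧ wordPhi a v = wordPhi a w + 1 := by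
  induction w generalizing v with
  | nil => simp [wordE] at h
  | cons x w ih =>
    rw [wordE] at h
    split_ifs at h with hx
    · obtain ⟨w', hw', rfl⟩ := Option.map_eq_some_iff.1 h
      obtain ⟨h1, h2, h3⟩ := ih hw'
      refine ⟨?_, ?_, ?_⟩
      · rw [wordF, if_pos (by omega), h1, Option.map_some]
      · rw [wordEps_cons, wordEps_cons]; omega
      · rw [wordPhi_cons, wordPhi_cons]; omega
    · obtain ⟨x', hx', rfl⟩ := Option.map_eq_some_iff.1 h
      obtain ⟨h1, h2, h3⟩ := letterE_some hx'
      refine ⟨?_, ?_, ?_⟩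
      · rw [wordF, if_neg (by omega), h1, Option.map_some]
      · rw [wordEps_cons, wordEps_cons]; omega
      · rw [wordPhi_cons, wordPhi_cons]; omega

lemma wordF_some {a : Idx} {w v : Word} (h : wordF a w = some v) :
    wordE a v = some w ∧ wordEps a v = wordEps a w + 1 ∧ wordPhi a w = wordPhi a v + 1 := by
  induction w generalizing v with
  | nil => simp [wordF] at h
  | cons x w ih =>
    rw [wordF] at h
    split_ifs at h with hx
    · obtain ⟨w', hw', rfl⟩ := Option.map_eq_some_iff.1 h
      obtain ⟨h1, h2, h3⟩ := ih hw'
      refine ⟨?_, ?_, ?_⟩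
      · rw [wordE, if_pos (by omega), h1, Option.map_some]
      · rw [wordEps_cons, wordEps_cons]; omega
      · rw [wordPhi_cons, wordPhi_cons]; omega
    · obtain ⟨x', hx', rfl⟩ := Option.map_eq_some_iff.1 h
      obtain ⟨h1, h2, h3⟩ := letterF_some hx'
      refine ⟨?_, ?_, ?_⟩
      · rw [wordE, if_neg (by omega), h1, Option.map_some]
      · rw [wordEps_cons, wordEps_cons]; omega
      · rw [wordPhi_cons, wordPhi_cons]; omega

lemma wordE_eq_none {a : Idx} {w : Word} : wordE a w = none ↔ wordEps a w = 0 := by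
  constructor
  · intro h
    induction w with
    | nil => simp
    | cons x w ih =>
      rw [wordE] at h
      rw [wordEps_cons]
      split_ifs at h with hx
      · have := ih (Option.map_eq_none_iff.1 h)
        omega
      · have := letterE_none (Option.map_eq_none_iff.1 h)
        omega
  · intro h
    cases h' : wordE a w with
    | none => rfl
    | some v => have := (wordE_some h').2.1; omega

lemma wordF_eq_none {a : Idx} {w : Word} : wordF a w = none ↔ wordPhi a w = 0 := by
  constructor
  · intro h
    induction w with
    | nil => simp
    | cons x w ih =>
      rw [wordF] at h
      rw [wordPhi_cons]
      split_ifs at h with hx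
      · have := ih (Option.map_eq_none_iff.1 h)
        omega
      · have := letterF_none (Option.map_eq_none_iff.1 h)
        omega
  · intro h
    cases h' : wordF a w with
    | none => rfl
    | some v => have := (wordF_some h').2.2; omega

lemma wordEps_wordPhi_append (a : Idx) (u w : Word) :
    wordEps a (u ++ w) = wordEps a w + (wordEps a u - wordPhi a w) ∧
      wordPhi a (u ++ w) = wordPhi a u + (wordPhi a w - wordEps a u) := by
  induction u with
  | nil => simp
  | cons x u ih =>
    rw [List.cons_append, wordEps_cons, wordPhi_cons, wordEps_cons, wordPhi_cons, ih.1, ih.2]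
    omega

lemma wordEps_append (a : Idx) (u w : Word) :
    wordEps a (u ++ w) = wordEps a w + (wordEps a u - wordPhi a w) :=
  (wordEps_wordPhi_append a u w).1

lemma wordPhi_append (a : Idx) (u w : Word) :
    wordPhi a (u ++ w) = wordPhi a u + (wordPhi a w - wordEps a u) :=
  (wordEps_wordPhi_append a u w).2

/-- The tensor product rule for the concatenation `[u w]`, which stands for `w ⊗ u`. -/
lemma wordE_append (a : Idx) (u w : Word) :
    wordE a (u ++ w) =
      if wordEps a u ≤ wordPhi a w then (wordE a w).map (u ++ ·)
      else (wordE a u).map (· ++ w) := by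
  induction u with
  | nil => simp
  | cons x u ih =>
    rw [List.cons_append, wordE, wordE, wordEps_cons, wordPhi_append, ih]
    by_cases h1 : wordEps a u ≤ wordPhi a w
    · by_cases h2 : letterEps a x ≤ wordPhi a u + (wordPhi a w - wordEps a u)
      · rw [if_pos h1, if_pos h2, if_pos (by omega), Option.map_map]; rfl
      · rw [if_neg h2, if_neg (by omega), if_neg (by omega), Option.map_map]; rfl
    · rw [if_neg h1, if_neg (c := _ ≤ wordPhi a w) (by omega)]
      by_cases h2 : letterEps a x ≤ wordPhi a u
      · rw [if_pos h2, if_pos (by omega), Option.map_map, Option.map_map]; rfl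
      · rw [if_neg h2, if_neg (by omega), Option.map_map]; rfl

lemma wordF_append (a : Idx) (u w : Word) :
    wordF a (u ++ w) =
      if wordEps a u < wordPhi a w then (wordF a w).map (u ++ ·)
      else (wordF a u).map (· ++ w) := by
  induction u with
  | nil =>
    simp only [List.nil_append, wordEps_nil, Option.map_id']
    split_ifs with h
    · rfl
    · rw [wordF_eq_none.2 (by omega), wordF, Option.map_none]
  | cons x u ih =>
    rw [List.cons_append, wordF, wordF, wordEps_cons, wordPhi_append, ih]
    by_cases h1 : wordEps a u < wordPhi a w
    · by_cases h2 : letterEps a x < wordPhi a u + (wordPhi a w - wordEps a u)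
      · rw [if_pos h1, if_pos h2, if_pos (by omega), Option.map_map]; rfl
      · rw [if_neg h2, if_neg (by omega), if_neg (by omega), Option.map_map]; rfl
    · rw [if_neg h1, if_neg (c := _ < wordPhi a w) (by omega)]
      by_cases h2 : letterEps a x < wordPhi a u
      · rw [if_pos h2, if_pos (by omega), Option.map_map, Option.map_map]; rfl
      · rw [if_neg h2, if_neg (by omega), Option.map_map]; rfl

/-- Powers of `ẽ_a` act on the right-hand part of a row as long as the left-hand part has too few
`ẽ_a`-arrows. -/
lemma iter_wordE_append_right {a : Idx} (n : ℕ) {u w v : Word} (hu : wordEps a u ≤ wordPhi a w)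
    (h : iter (wordE a) n (some w) = some v) :
    iter (wordE a) n (some (u ++ w)) = some (u ++ v) := by
  induction n generalizing w with
  | zero => simp only [iter_zero, Option.some.injEq] at h ⊢; rw [h]
  | succ n ih =>
    obtain ⟨w', hw', h⟩ := iter_succ_eq_some.1 h
    have := (wordE_some hw').2.2
    refine iter_succ_eq_some.2 ⟨u ++ w', ?_, ih (by omega) h⟩
    rw [wordE_append, if_pos hu, hw', Option.map_some]

lemma iter_wordE_append_left {a : Idx} (n : ℕ) {u w v : Word}
    (hu : wordPhi a w + n ≤ wordEps a u) (h : iter (wordE a) n (some u) = some v) :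
    iter (wordE a) n (some (u ++ w)) = some (v ++ w) := by
  induction n generalizing u with
  | zero => simp only [iter_zero, Option.some.injEq] at h ⊢; rw [h]
  | succ n ih =>
    obtain ⟨u', hu', h⟩ := iter_succ_eq_some.1 h
    have := (wordE_some hu').2.1
    refine iter_succ_eq_some.2 ⟨u' ++ w, ?_, ih (by omega) h⟩
    rw [wordE_append, if_neg (by omega), hu', Option.map_some]

lemma iter_wordF_append_right {a : Idx} (n : ℕ) {u w v : Word}
    (hu : wordEps a u + n ≤ wordPhi a w) (h : iter (wordF a) n (some w) = some v) :
    iter (wordF a) n (some (u ++ w)) = some (u ++ v) := by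
  induction n generalizing w with
  | zero => simp only [iter_zero, Option.some.injEq] at h ⊢; rw [h]
  | succ n ih =>
    obtain ⟨w', hw', h⟩ := iter_succ_eq_some.1 h
    have := (wordF_some hw').2.2
    refine iter_succ_eq_some.2 ⟨u ++ w', ?_, ih (by omega) h⟩
    rw [wordF_append, if_pos (by omega), hw', Option.map_some]

lemma iter_wordF_append_left {a : Idx} (n : ℕ) {u w v : Word} (hu : wordPhi a w ≤ wordEps a u)
    (h : iter (wordF a) n (some u) = some v) :
    iter (wordF a) n (some (u ++ w)) = some (v ++ w) := by
  induction n generalizing u with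
  | zero => simp only [iter_zero, Option.some.injEq] at h ⊢; rw [h]
  | succ n ih =>
    obtain ⟨u', hu', h⟩ := iter_succ_eq_some.1 h
    have := (wordF_some hu').2.1
    refine iter_succ_eq_some.2 ⟨u' ++ w, ?_, ih (by omega) h⟩
    rw [wordF_append, if_neg (by omega), hu', Option.map_some]

/-! ### The involution `C_𝒢` -/

lemma barLetter_barLetter (x : Letter) : barLetter (barLetter x) = x := by cases x <;> rfl

lemma letterEps_bar (a : Idx) (x : Letter) : letterEps a (barLetter x) = letterPhi a x := by
  cases a <;> cases x <;> rfl

lemma letterPhi_bar (a : Idx) (x : Letter) : letterPhi a (barLetter x) = letterEps a x := by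
  cases a <;> cases x <;> rfl

lemma letterF_bar (a : Idx) (x : Letter) :
    letterF a (barLetter x) = (letterE a x).map barLetter := by
  cases a <;> cases x <;> rfl

@[simp] lemma CG_nil : CG [] = [] := rfl

lemma CG_append (u w : Word) : CG (u ++ w) = CG w ++ CG u := by simp [CG]

lemma CG_cons (x : Letter) (w : Word) : CG (x :: w) = CG w ++ [barLetter x] := by simp [CG]

lemma CG_CG (w : Word) : CG (CG w) = w := by
  simp [CG, List.map_reverse, Function.comp_def, barLetter_barLetter]

lemma CG_box (x : Letter) (n : ℕ) : CG (box x n) = box (barLetter x) n := by simp [CG, box]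

lemma wordEps_wordPhi_CG (a : Idx) (w : Word) :
    wordEps a (CG w) = wordPhi a w ∧ wordPhi a (CG w) = wordEps a w := by
  induction w with
  | nil => simp
  | cons x w ih =>
    rw [CG_cons, wordEps_append, wordPhi_append, ih.1, ih.2]
    simp [wordEps_cons, wordPhi_cons, letterEps_bar, letterPhi_bar]

/-- `C_𝒢` exchanges `ẽ_a` and `f̃_a`. -/
lemma wordF_CG (a : Idx) (w : Word) : wordF a (CG w) = (wordE a w).map CG := by
  induction w with
  | nil => rfl
  | cons x w ih =>
    have hx : wordF a [barLetter x] = (letterE a x).map (fun y => CG [y]) := by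
      simp [wordF, letterF_bar, CG, Function.comp_def]
    have hp : wordPhi a [barLetter x] = letterEps a x := by
      simp [wordPhi_cons, letterPhi_bar]
    rw [CG_cons, wordF_append, (wordEps_wordPhi_CG a w).1, hp, wordE, ih, hx]
    by_cases h : letterEps a x ≤ wordPhi a w
    · rw [if_neg (by omega), if_pos h, Option.map_map, Option.map_map]
      congr 1
      funext y
      simp [CG_cons]
    · rw [if_pos (by omega), if_neg h, Option.map_map, Option.map_map]
      congr 1
      funext y
      simp [CG_cons]

lemma wordE_CG (a : Idx) (w : Word) : wordE a (CG w) = (wordF a w).map CG := by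
  have h := wordF_CG a (CG w)
  rw [CG_CG] at h
  rw [h, Option.map_map]
  simp [Function.comp_def, CG_CG]

/-! ### Rows in `B(nΛ₁)` as Lakshmibai–Seshadri paths -/

/-- A letter is a Lakshmibai–Seshadri path, whose directions are long roots. Those form the chain
`1 < 2 < 6 < 6̄ < 2̄ < 1̄`, here numbered `0, …, 5`; this is the smallest direction. -/
def loDir : Letter → ℕ
  | n1 => 0 | n2 => 1 | n3 => 1 | n4 => 1 | n5 => 1 | n6 => 2
  | z1 => 2 | z2 => 1
  | b6 => 3 | b5 => 2 | b4 => 3 | b3 => 3 | b2 => 4 | b1 => 5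

/-- The largest direction of a letter, in the numbering of `loDir`. -/
def hiDir : Letter → ℕ
  | n1 => 0 | n2 => 1 | n3 => 2 | n4 => 2 | n5 => 3 | n6 => 2
  | z1 => 3 | z2 => 4
  | b6 => 3 | b5 => 4 | b4 => 4 | b3 => 4 | b2 => 4 | b1 => 5

/-- The standard rows: the directions of each letter are at most those of the next one. -/
def Standard (w : Word) : Prop := w.Pairwise fun x y => hiDir x ≤ loDir y

lemma loDir_le_hiDir (x : Letter) : loDir x ≤ hiDir x := by cases x <;> decide

lemma standard_cons_cons {x y : Letter} {w : Word} :
    Standard (x :: y :: w) ↔ hiDir x ≤ loDir y ∧ Standard (y :: w) := by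
  unfold Standard
  rw [List.pairwise_cons]
  refine ⟨fun h => ⟨h.1 y (by simp), h.2⟩, fun h => ⟨fun z hz => ?_, h.2⟩⟩
  rcases List.mem_cons.1 hz with rfl | hz
  · exact h.1
  · have := (List.pairwise_cons.1 h.2).1 z hz
    have := loDir_le_hiDir y
    omega

/-- In a standard pair, `ẽ_a` applied to the letter chosen by the tensor product rule gives a
standard pair. -/
lemma standard_pair_letterE {a : Idx} {x y : Letter} (h : hiDir x ≤ loDir y) :
    (∀ y', letterE a y = some y' → letterEps a x ≤ letterPhi a y → hiDir x ≤ loDir y') ∧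
      (∀ x', letterE a x = some x' → letterPhi a y < letterEps a x → hiDir x' ≤ loDir y) := by
  cases a <;> cases x <;> cases y <;>
    simp_all [hiDir, loDir, letterE, letterEps, letterPhi]

lemma Standard.wordE {a : Idx} {w v : Word} (hw : Standard w) (h : wordE a w = some v) :
    Standard v := by
  induction w generalizing v with
  | nil => simp [G2Crystal.wordE] at h
  | cons x w ih =>
    have hw' : Standard w := (List.pairwise_cons.1 hw).2
    rw [G2Crystal.wordE] at h
    split_ifs at h with hx
    · obtain ⟨w', hw'', rfl⟩ := Option.map_eq_some_iff.1 h
      have hs := ih hw' hw''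
      cases w with
      | nil => simp [G2Crystal.wordE] at hw''
      | cons y w =>
        have hxy := (standard_cons_cons.1 hw).1
        rw [G2Crystal.wordE] at hw''
        split_ifs at hw'' with hy
        · obtain ⟨w₁, -, rfl⟩ := Option.map_eq_some_iff.1 hw''
          exact standard_cons_cons.2 ⟨hxy, hs⟩
        · obtain ⟨y', hy', rfl⟩ := Option.map_eq_some_iff.1 hw''
          rw [wordPhi_cons] at hx
          exact standard_cons_cons.2
            ⟨(standard_pair_letterE hxy).1 y' hy' (by omega), hs⟩
    · obtain ⟨x', hx', rfl⟩ := Option.map_eq_some_iff.1 h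
      cases w with
      | nil => exact List.pairwise_singleton _ _
      | cons y w =>
        have hxy := (standard_cons_cons.1 hw).1
        rw [wordPhi_cons] at hx
        exact standard_cons_cons.2
          ⟨(standard_pair_letterE hxy).2 x' hx' (by omega), hw'⟩

/-- The only standard row of highest weight is `[1 ⋯ 1]`. -/
lemma Standard.eq_replicate_of_wordEps_eq_zero {w : Word} (hw : Standard w)
    (h : ∀ a, wordEps a w = 0) : w = List.replicate w.length n1 := by
  induction w with
  | nil => rfl
  | cons x w ih =>
    have ih := ih (List.pairwise_cons.1 hw).2 fun a => by
      have := h a; rw [wordEps_cons] at this; omega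
    have hx : x = n1 := by
      cases w with
      | nil =>
        have h1 := h i1
        have h2 := h i2
        simp only [wordEps_cons, wordEps_nil, wordPhi_nil] at h1 h2
        cases x <;> first | rfl | (simp [letterEps] at h1; done) | (simp [letterEps] at h2)
      | cons y w =>
        have hy : y = n1 := by
          rw [List.length_cons, List.replicate_succ] at ih
          exact (List.cons.inj ih).1
        have hxy := (standard_cons_cons.1 hw).1
        subst hy
        cases x <;> first | rfl | (simp [hiDir, loDir] at hxy)
    rw [List.length_cons, List.replicate_succ, ← ih, hx]

/-- The depth of a letter in the crystal graph, which `ẽ_a` lowers by one. -/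
def depth : Letter → ℕ
  | n1 => 0 | n2 => 1 | n3 => 2 | n4 => 3 | n5 => 4 | n6 => 4
  | z1 => 5 | z2 => 5
  | b6 => 6 | b5 => 6 | b4 => 7 | b3 => 8 | b2 => 9 | b1 => 10

lemma wordE_length_depth {a : Idx} {w v : Word} (h : wordE a w = some v) :
    v.length = w.length ∧ (v.map depth).sum + 1 = (w.map depth).sum := by
  induction w generalizing v with
  | nil => simp [wordE] at h
  | cons x w ih =>
    rw [wordE] at h
    split_ifs at h with hx
    · obtain ⟨w', hw', rfl⟩ := Option.map_eq_some_iff.1 h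
      have := ih hw'
      simp only [List.length_cons, List.map_cons, List.sum_cons]
      omega
    · obtain ⟨x', hx', rfl⟩ := Option.map_eq_some_iff.1 h
      have : depth x' + 1 = depth x := by
        cases a <;> cases x <;>
          first | (simp [letterE] at hx'; done) | (obtain rfl := Option.some.inj hx'; rfl)
      refine ⟨rfl, ?_⟩
      simp only [List.map_cons, List.sum_cons]
      omega

lemma wordF_mem_BG2 {n : ℕ} {a : Idx} {w v : Word} (hw : w ∈ BG2 n) (h : wordF a w = some v) :
    v ∈ BG2 n :=
  Relation.ReflTransGen.tail hw ⟨a, Or.inl h⟩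

lemma wordE_mem_BG2 {n : ℕ} {a : Idx} {w v : Word} (hw : w ∈ BG2 n) (h : wordE a w = some v) :
    v ∈ BG2 n :=
  Relation.ReflTransGen.tail hw ⟨a, Or.inr h⟩

lemma Standard.mem_BG2 {w : Word} (hw : Standard w) : w ∈ BG2 w.length := by
  induction hd : (w.map depth).sum using Nat.strong_induction_on generalizing w with
  | _ d ih =>
    by_cases h : ∀ a, wordEps a w = 0
    · have := hw.eq_replicate_of_wordEps_eq_zero h
      rw [BG2, Set.mem_ofPred_eq, ← this]
    · push Not at h
      obtain ⟨a, ha⟩ := h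
      cases hv : G2Crystal.wordE a w with
      | none => exact absurd (wordE_eq_none.1 hv) ha
      | some v =>
        have hl := wordE_length_depth hv
        have := ih _ (by omega) (hw.wordE hv) rfl
        rw [hl.1] at this
        exact wordF_mem_BG2 this (wordE_some hv).1

lemma CG_mem_BG2 {n : ℕ} {w : Word} (hw : w ∈ BG2 n) : CG w ∈ BG2 n := by
  induction hw with
  | refl =>
    -- the row `[1̄ ⋯ 1̄]` is standard
    have h : Standard (List.replicate n b1) := by
      simp [Standard, List.pairwise_replicate, hiDir, loDir]
    have := h.mem_BG2
    rwa [List.length_replicate, ← show CG (List.replicate n n1) = List.replicate n b1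
      from CG_box n1 n] at this
  | tail _ h ih =>
    obtain ⟨a, h | h⟩ := h
    · exact wordE_mem_BG2 (a := a) ih (by rw [wordE_CG, h, Option.map_some])
    · exact wordF_mem_BG2 (a := a) ih (by rw [wordF_CG, h, Option.map_some])

lemma CG_mem_calG {l : ℕ} {w : Word} (hw : w ∈ calG l) : CG w ∈ calG l := by
  obtain ⟨n, hn, hw⟩ := hw
  exact ⟨n, hn, CG_mem_BG2 hw⟩

lemma wordE_mem_calG {l : ℕ} {a : Idx} {w v : Word} (hw : w ∈ calG l) (h : wordE a w = some v) :
    v ∈ calG l := by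
  obtain ⟨n, hn, hw⟩ := hw
  exact ⟨n, hn, wordE_mem_BG2 hw h⟩

lemma wordF_mem_calG {l : ℕ} {a : Idx} {w v : Word} (hw : w ∈ calG l) (h : wordF a w = some v) :
    v ∈ calG l := by
  obtain ⟨n, hn, hw⟩ := hw
  exact ⟨n, hn, wordF_mem_BG2 hw h⟩

/-! ### Rows of blocks -/

lemma box_succ (x : Letter) (n : ℕ) : box x (n + 1) = [x] ++ box x n := rfl

lemma box_succ' (x : Letter) (n : ℕ) : box x (n + 1) = box x n ++ [x] :=
  List.replicate_succ'

lemma box_add (x : Letter) (m n : ℕ) : box x (m + n) = box x m ++ box x n :=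
  List.replicate_add _ _ _

@[simp] lemma box_zero (x : Letter) : box x 0 = [] := rfl

@[simp] lemma box_one (x : Letter) : box x 1 = [x] := rfl

@[simp] lemma length_box (x : Letter) (n : ℕ) : (box x n).length = n := List.length_replicate

lemma wordEps_singleton (a : Idx) (x : Letter) : wordEps a [x] = letterEps a x := by
  simp [wordEps_cons]

lemma wordPhi_singleton (a : Idx) (x : Letter) : wordPhi a [x] = letterPhi a x := by
  simp [wordPhi_cons]

lemma wordPhi_box_of_letterPhi {a : Idx} {x : Letter} (hx : letterPhi a x = 0) (n : ℕ) :
    wordPhi a (box x n) = 0 := by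
  induction n with
  | zero => simp
  | succ n ih => rw [box_succ, wordPhi_append, ih, wordPhi_singleton, hx]; simp

lemma wordEps_box_of_letterEps {a : Idx} {x : Letter} (hx : letterEps a x = 0) (n : ℕ) :
    wordEps a (box x n) = 0 := by
  induction n with
  | zero => simp
  | succ n ih => rw [box_succ, wordEps_append, ih, wordEps_singleton, hx]; simp

lemma wordEps_box {a : Idx} {x : Letter} (hx : letterPhi a x = 0) (n : ℕ) :
    wordEps a (box x n) = letterEps a x * n := by
  induction n with
  | zero => simp
  | succ n ih =>
    rw [box_succ, wordEps_append, ih, wordEps_singleton, wordPhi_box_of_letterPhi hx,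
      Nat.mul_succ, Nat.sub_zero]

lemma wordPhi_box {a : Idx} {x : Letter} (hx : letterEps a x = 0) (n : ℕ) :
    wordPhi a (box x n) = letterPhi a x * n := by
  induction n with
  | zero => simp
  | succ n ih =>
    rw [box_succ, wordPhi_append, ih, wordPhi_singleton, wordEps_singleton, hx, Nat.mul_succ,
      Nat.sub_zero,
      Nat.add_comm]

lemma length_blockC (v : ℕ) : (blockC v).length = v := by
  simp only [blockC, List.length_append, length_box]
  omega

lemma CG_blockC (v : ℕ) : CG (blockC v) = blockC v := by
  simp [blockC, CG_append, CG_box, barLetter]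

lemma wordEps_i1_blockC (v : ℕ) : wordEps i1 (blockC v) = v := by
  simp only [blockC, wordEps_append]
  rw [wordPhi_box_of_letterPhi (x := b6) rfl, wordEps_box (x := b6) rfl,
    wordEps_box_of_letterEps (x := n6) rfl]
  rcases Nat.mod_two_eq_zero_or_one v with h | h <;> rw [h] <;>
    simp [wordEps_cons, letterEps] <;> omega

lemma wordEps_i2_blockC (v : ℕ) : wordEps i2 (blockC v) = 0 := by
  simp only [blockC, wordEps_append]
  rw [wordPhi_box (x := b6) rfl, wordEps_box (x := n6) rfl,
    wordEps_box_of_letterEps (x := b6) rfl, wordEps_box_of_letterEps (x := z1) rfl]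
  rcases Nat.mod_two_eq_zero_or_one v with h | h <;> rw [h] <;>
    simp [wordPhi_cons, letterEps, letterPhi]

lemma wordPhi_i2_blockC (v : ℕ) : wordPhi i2 (blockC v) = 0 := by
  rw [← CG_blockC, (wordEps_wordPhi_CG _ _).2, wordEps_i2_blockC]

/-- The middle part of the rows below: the block `𝒞^v` with `x` additional letters `6` on its left
and, depending on the residue `c`, one further letter on its right. For `c = 1` that letter is
`4̄`, which takes the place of one unit of `v`; if there is none, `5̄` replaces the pair
`6 4̄`. In all cases `ε₁ = v`. -/
def midRow (c x v : ℕ) : Word :=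
  if c = 0 then box n6 x ++ blockC v
  else if c = 1 then
    if v = 0 then box n6 (x - 1) ++ [b5] else box n6 x ++ (blockC (v - 1) ++ [b4])
  else box n6 x ++ (blockC v ++ [b3])

/-- The rows that occur as `f̃₁^q Φ(f̃₀^p h)`. -/
def row (c a x v n d : ℕ) : Word :=
  (box n1 a ++ midRow c x v) ++ (box b2 n ++ box b1 d)

lemma wordEps_i1_midRow (c x v : ℕ) : wordEps i1 (midRow c x v) = v := by
  unfold midRow
  split_ifs with h1 h2 h3
  · rw [wordEps_append, wordEps_i1_blockC, wordEps_box_of_letterEps rfl]; simp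
  · rw [wordEps_append, wordEps_box_of_letterEps rfl]; simp [wordEps_cons, letterEps, h3]
  · rw [wordEps_append, wordEps_append, wordEps_i1_blockC, wordEps_box_of_letterEps rfl]
    simp [wordEps_cons, wordPhi_cons, letterEps, letterPhi]
    omega
  · rw [wordEps_append, wordEps_append, wordEps_i1_blockC, wordEps_box_of_letterEps rfl]
    simp [wordEps_cons, wordPhi_cons, letterEps, letterPhi]

lemma wordF_i1_blockC (x v : ℕ) :
    wordF i1 (box n6 (x + 1) ++ blockC v) = some (box n6 x ++ blockC (v + 1)) := by
  have h6 : ∀ m, wordEps i1 (box n6 m) = 0 := wordEps_box_of_letterEps rfl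
  have hp : ∀ m, wordPhi i1 (box b6 m) = 0 := wordPhi_box_of_letterPhi rfl
  rcases Nat.even_or_odd' v with ⟨h, rfl | rfl⟩
  · have e1 : box n6 (x + 1) ++ blockC (2 * h) = box n6 (x + h) ++ (n6 :: box b6 h) := by
      rw [blockC, show 2 * h / 2 = h by omega, show 2 * h % 2 = 0 by omega, box_zero,
        List.append_nil, ← List.append_assoc, ← box_add, show x + 1 + h = x + h + 1 by omega,
        box_succ', List.append_assoc]; rfl
    have e2 : box n6 x ++ blockC (2 * h + 1) = box n6 (x + h) ++ (z1 :: box b6 h) := by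
      rw [blockC, show (2 * h + 1) / 2 = h by omega, show (2 * h + 1) % 2 = 1 by omega, box_one,
        ← List.append_assoc, ← List.append_assoc, ← box_add, List.append_assoc]; rfl
    rw [e1, e2, wordF_append, if_pos, wordF, if_neg] <;>
      simp [h6, hp, wordPhi_cons, letterPhi, letterF]
  · have e1 : box n6 (x + 1) ++ blockC (2 * h + 1) = box n6 (x + 1 + h) ++ (z1 :: box b6 h) := by
      rw [blockC, show (2 * h + 1) / 2 = h by omega, show (2 * h + 1) % 2 = 1 by omega, box_one,
        ← List.append_assoc, ← List.append_assoc, ← box_add, List.append_assoc]; rfl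
    have e2 : box n6 x ++ blockC (2 * h + 1 + 1) = box n6 (x + 1 + h) ++ (b6 :: box b6 h) := by
      rw [blockC, show (2 * h + 1 + 1) / 2 = h + 1 by omega,
        show (2 * h + 1 + 1) % 2 = 0 by omega, box_zero, List.append_nil, ← List.append_assoc,
        ← box_add, show x + 1 + h = x + (h + 1) by omega]; rfl
    rw [e1, e2, wordF_append, if_pos, wordF, if_neg] <;>
      simp [h6, hp, wordPhi_cons, letterPhi, letterF]

lemma wordF_i1_midRow {c x v : ℕ} :
    wordF i1 (midRow c (x + 1) v) = some (midRow c x (v + 1)) := by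
  have h6 : ∀ m, wordEps i1 (box n6 m) = 0 := wordEps_box_of_letterEps rfl
  unfold midRow
  by_cases h1 : c = 0
  · rw [if_pos h1, if_pos h1, wordF_i1_blockC]
  rw [if_neg h1, if_neg h1]
  by_cases h2 : c = 1
  · rw [if_pos h2, if_pos h2, if_neg (Nat.succ_ne_zero v)]
    rcases v with _ | v
    · rw [if_pos rfl, wordF_append, if_pos] <;>
        simp [h6, wordPhi_cons, letterPhi, wordF, letterF, blockC]
    · rw [if_neg (Nat.succ_ne_zero v), ← List.append_assoc, wordF_append, if_neg,
        Nat.add_sub_cancel, wordF_i1_blockC] <;> simp [wordPhi_cons, letterPhi]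
  · rw [if_neg h2, if_neg h2, ← List.append_assoc, wordF_append, if_neg, wordF_i1_blockC] <;>
      simp [wordPhi_cons, letterPhi]

lemma iter_wordF_i1_midRow (c a x v k : ℕ) :
    iter (wordF i1) k (some (box n1 a ++ midRow c (x + k) v)) =
      some (box n1 a ++ midRow c x (v + k)) := by
  induction k generalizing v with
  | zero => rfl
  | succ k ih =>
    refine iter_succ_eq_some.2 ⟨box n1 a ++ midRow c (x + k) (v + 1), ?_, ?_⟩
    · have h : wordF i1 (midRow c (x + (k + 1)) v) = _ := wordF_i1_midRow
      have := (wordF_some h).2.2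
      rw [wordF_append, if_pos (by rw [wordEps_box_of_letterEps rfl]; omega), h,
        Option.map_some]
      rfl
    · rw [ih, show v + 1 + k = v + (k + 1) by omega]

lemma wordPhi_i1_tail (n d : ℕ) : wordPhi i1 (box b2 n ++ box b1 d) = n := by
  rw [wordPhi_append, wordPhi_box rfl, wordPhi_box_of_letterPhi rfl]
  simp [letterPhi]

lemma iter_wordF_i1_tail (n d g : ℕ) :
    iter (wordF i1) g (some (box b2 (n + g) ++ box b1 d)) =
      some (box b2 n ++ box b1 (d + g)) := by
  induction g generalizing d with
  | zero => rfl
  | succ g ih =>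
    refine iter_succ_eq_some.2 ⟨box b2 (n + g) ++ box b1 (d + 1), ?_, ?_⟩
    · rw [← Nat.add_assoc, box_succ', List.append_assoc, wordF_append, if_pos]
      · have h : wordPhi i1 (box b1 d) = 0 := wordPhi_box_of_letterPhi rfl _
        rw [List.singleton_append, wordF, if_neg (by simp [h])]
        simp [letterF, box_succ]
      · rw [wordEps_box_of_letterEps rfl, List.singleton_append, wordPhi_cons]
        simp [letterPhi]
    · rw [ih, show d + 1 + g = d + (g + 1) by omega]

/-- `f̃₁` first turns the letters `2̄` that are not cancelled by the `v` arrows of the middle part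
into `1̄`, and then acts on the middle part. -/
lemma iter_wordF_i1_row {c a x v n q : ℕ} (hv : v ≤ n) (hq : q ≤ n - v + x) :
    iter (wordF i1) q (some (row c a x v n 0)) =
      some (row c a (x - (q - (n - v))) (v + (q - (n - v))) (n - min q (n - v))
        (min q (n - v))) := by
  have heps : ∀ x v, wordEps i1 (box n1 a ++ midRow c x v) = v := fun x v => by
    rw [wordEps_append, wordEps_i1_midRow, wordEps_box_of_letterEps rfl]; simp
  have h1 := iter_wordF_i1_tail (n - min q (n - v)) 0 (min q (n - v))
  have h2 := iter_wordF_i1_midRow c a (x - (q - (n - v))) v (q - (n - v))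
  rw [Nat.zero_add, show n - min q (n - v) + min q (n - v) = n by omega] at h1
  rw [show x - (q - (n - v)) + (q - (n - v)) = x by omega] at h2
  conv_lhs => rw [show q = min q (n - v) + (q - (n - v)) by omega]
  rw [iter_add, row, iter_wordF_append_right _ _ h1]
  · rcases Nat.le_total q (n - v) with h | h
    · simp [row, Nat.sub_eq_zero_of_le h]
    · exact iter_wordF_append_left _ (by rw [heps, wordPhi_i1_tail]; omega) h2
  · rw [heps, wordPhi_i1_tail]; omega

/-! ### The highest elements of `2`-strings through rows of blocks -/

lemma wordEps_iter_wordE {a : Idx} {n : ℕ} {u v : Word} (h : iter (wordE a) n (some u) = some v) :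
    wordEps a u = wordEps a v + n := by
  induction n generalizing u with
  | zero => simp only [iter_zero, Option.some.injEq] at h; rw [h]; rfl
  | succ n ih =>
    obtain ⟨u', hu', h⟩ := iter_succ_eq_some.1 h
    have := (wordE_some hu').2.1
    have := ih h
    omega

/-- `ẽ_a` applied to `[u w]` acts first on `u`, until its `ẽ_a`-arrows are cancelled by `w`, and
then on `w`. -/
lemma iter_wordE_append {a : Idx} {m n : ℕ} {u w u' w' : Word}
    (hm : wordEps a u = wordPhi a w + m) (hu : iter (wordE a) m (some u) = some u')
    (hw : iter (wordE a) n (some w) = some w') :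
    iter (wordE a) (m + n) (some (u ++ w)) = some (u' ++ w') := by
  have := wordEps_iter_wordE hu
  rw [iter_add, iter_wordE_append_left m (by omega) hu,
    iter_wordE_append_right n (by omega) hw]

lemma iter_wordE_box {a : Idx} {x y : Letter} {k : ℕ} (hk : letterEps a x = k)
    (hx : letterPhi a x = 0) (h : iter (wordE a) k (some [x]) = some [y]) (n : ℕ) :
    iter (wordE a) (k * n) (some (box x n)) = some (box y n) := by
  induction n with
  | zero => rfl
  | succ n ih =>
    rw [Nat.mul_succ, Nat.add_comm, box_succ, box_succ]
    exact iter_wordE_append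
      (by rw [wordEps_singleton, hk, wordPhi_box_of_letterPhi hx, Nat.zero_add]) h ih

lemma iter_wordE_i2_box_n6 (x : ℕ) :
    iter (wordE i2) (3 * x) (some (box n6 x)) = some (box n2 x) :=
  iter_wordE_box (a := i2) (x := n6) rfl rfl rfl x

lemma iter_wordE_i2_box_b2 (n : ℕ) :
    iter (wordE i2) (3 * n) (some (box b2 n)) = some (box b6 n) :=
  iter_wordE_box (a := i2) (x := b2) rfl rfl rfl n

lemma iter_wordE_i2_box_n6_succ {k : ℕ} {y : Letter}
    (h : iter (wordE i2) k (some [n6]) = some [y]) (x : ℕ) :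
    iter (wordE i2) (3 * x + k) (some (box n6 (x + 1))) = some (box n2 x ++ [y]) := by
  rw [box_succ']
  refine iter_wordE_append ?_ (iter_wordE_i2_box_n6 x) h
  rw [wordEps_box rfl, wordPhi_singleton]
  simp [letterEps, letterPhi]

/-- The highest element of the `2`-string through a row of blocks is again a row of blocks, up to
`C_𝒢`. -/
lemma iter_wordE_i2_midRow {c x n : ℕ} (v K : ℕ) (hc : c < 3) (hx : c ≠ 0 → 0 < x)
    (hK : K = if c = 0 then 3 * x + 3 * n else if c = 1 then 3 * x + 3 * n - 1
      else 3 * x + 3 * n + 1) :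
    iter (wordE i2) K (some (midRow c x v ++ box b2 n)) =
      some (box n2 (x - if c = 0 then 0 else 1) ++
        CG (midRow c (n + if c = 0 then 0 else 1) v)) := by
  have hb := iter_wordE_i2_box_b2 n
  have hb0 : wordPhi i2 (box b2 n) = 0 := wordPhi_box_of_letterPhi rfl n
  have h6 : ∀ m, wordEps i2 (box n6 m) = 3 * m := wordEps_box rfl
  obtain rfl | rfl | rfl : c = 0 ∨ c = 1 ∨ c = 2 := by omega
  · have hw := iter_wordE_append_right (u := blockC v) _
      (by rw [wordEps_i2_blockC]; exact Nat.zero_le _) hb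
    have := iter_wordE_append (u := box n6 x) (m := 3 * x)
      (by rw [h6, wordPhi_append, wordPhi_i2_blockC, hb0]; simp) (iter_wordE_i2_box_n6 x) hw
    simpa [hK, midRow, CG_append, CG_box, CG_blockC, barLetter] using this
  · obtain ⟨x, rfl⟩ : ∃ x', x = x' + 1 := ⟨x - 1, by have := hx one_ne_zero; omega⟩
    rcases Nat.eq_zero_or_pos v with rfl | hv
    · have hw : iter (wordE i2) (2 + 3 * n) (some ([b5] ++ box b2 n)) = some ([n5] ++ box b6 n) :=
        iter_wordE_append (by rw [wordEps_singleton, hb0]; rfl) rfl hb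
      have := iter_wordE_append (u := box n6 x) (m := 3 * x)
        (by rw [h6, wordPhi_append, hb0, wordPhi_singleton]; simp [letterPhi])
        (iter_wordE_i2_box_n6 x) hw
      rw [hK, if_neg one_ne_zero, if_pos rfl,
        show 3 * (x + 1) + 3 * n - 1 = 3 * x + (2 + 3 * n) by omega]
      simpa [midRow, CG_append, CG_box, CG_cons, barLetter] using this
    · have hw : iter (wordE i2) (1 + 3 * n) (some ([b4] ++ box b2 n)) = some ([b6] ++ box b6 n) :=
        iter_wordE_append (by rw [wordEps_singleton, hb0]; rfl) rfl hb
      have hw := iter_wordE_append_right (u := blockC (v - 1)) _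
        (by rw [wordEps_i2_blockC]; exact Nat.zero_le _) hw
      have := iter_wordE_append (u := box n6 (x + 1)) (m := 3 * x + 1)
        (by
          rw [h6, wordPhi_append, wordPhi_append, wordPhi_i2_blockC, wordEps_i2_blockC, hb0,
            wordPhi_singleton]
          simp [letterPhi]; omega)
        (iter_wordE_i2_box_n6_succ (y := n4) rfl x) hw
      rw [hK, if_neg one_ne_zero, if_pos rfl,
        show 3 * (x + 1) + 3 * n - 1 = 3 * x + 1 + (1 + 3 * n) by omega]
      simpa [midRow, CG_append, CG_box, CG_cons, CG_blockC, barLetter, hv.ne', box_succ']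
        using this
  · obtain ⟨x, rfl⟩ : ∃ x', x = x' + 1 := ⟨x - 1, by have := hx two_ne_zero; omega⟩
    have hw : iter (wordE i2) (2 + 3 * n) (some ([b3] ++ box b2 n)) = some ([b6] ++ box b6 n) :=
      iter_wordE_append (by rw [wordEps_singleton, hb0]; rfl) rfl hb
    have hw := iter_wordE_append_right (u := blockC v) _
      (by rw [wordEps_i2_blockC]; exact Nat.zero_le _) hw
    have := iter_wordE_append (u := box n6 (x + 1)) (m := 3 * x + 2)
      (by
        rw [h6, wordPhi_append, wordPhi_append, wordPhi_i2_blockC, wordEps_i2_blockC, hb0,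
          wordPhi_singleton]
        simp [letterPhi]; omega)
      (iter_wordE_i2_box_n6_succ (y := n3) rfl x) hw
    rw [hK, if_neg two_ne_zero, if_neg (by omega),
      show 3 * (x + 1) + 3 * n + 1 = 3 * x + 2 + (2 + 3 * n) by omega]
    simpa [midRow, CG_append, CG_box, CG_cons, CG_blockC, barLetter, box_succ'] using this

lemma iter_wordE_i2_row {c x n : ℕ} (a v d K : ℕ) (hc : c < 3) (hx : c ≠ 0 → 0 < x)
    (hK : K = if c = 0 then 3 * x + 3 * n else if c = 1 then 3 * x + 3 * n - 1
      else 3 * x + 3 * n + 1) :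
    iter (wordE i2) K (some (row c a x v n d)) =
      some (CG (row c d (n + if c = 0 then 0 else 1) v (x - if c = 0 then 0 else 1) a)) := by
  have h := iter_wordE_i2_midRow v K hc hx hK
  have h := iter_wordE_append_right (u := box n1 a) _
    (by rw [wordEps_box_of_letterEps rfl]; exact Nat.zero_le _) h
  have heps := wordEps_iter_wordE h
  have h := iter_wordE_append_left (w := box b1 d) K
    (by rw [wordPhi_box_of_letterPhi rfl]; omega) h
  simpa [row, CG_append, CG_box, barLetter] using h

/-! ### The tableaux `Φ(f̃₀^p h)` -/

/-- The cases in the definition of `Φ(f̃₀^p h)` are one family of rows of blocks. -/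
lemma PhiTop_eq_row {l i j p : ℕ} (hp : p ≤ j) :
    PhiTop l i j p = row ((l - i - j) % 3) (min p i)
      (yy l i j + (p - i) + if (l - i - j) % 3 = 0 then 0 else 1) (yy l i j + (i - p))
      (yy l i j + j - (p - i)) 0 := by
  unfold PhiTop row midRow
  generalize yy l i j = y
  by_cases h : p ≤ i
  · simp only [if_pos h, Nat.min_eq_left h, Nat.sub_eq_zero_of_le h, Nat.add_zero, Nat.sub_zero]
    split_ifs with h1 h2 h3 h4 h5
    · simp [Nat.add_sub_assoc h]
    · omega
    · simp [Nat.add_sub_assoc h]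
    · obtain ⟨rfl, rfl⟩ : y = 0 ∧ p = i := by omega
      simp
    · omega
    · simp [Nat.add_sub_assoc h]
  · have e1 : y + j + i - p = y + j - (p - i) := by omega
    have e2 : i - p = 0 := by omega
    have e3 : min p i = i := by omega
    simp only [if_neg h, e1, e2, e3, Nat.add_zero]
    split_ifs with h1 h2 h3 h4 h5
    · simp [Nat.add_comm]
    · omega
    · simp [Nat.add_comm]
    · obtain rfl : y = 0 := by omega
      simp [show j + i - p = j - (p - i) by omega]
    · omega
    · simp [Nat.add_comm]

lemma standard_row {c a x v n : ℕ} : Standard (row c a x v n 0) := by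
  have h2 : v % 2 ≤ 1 := by omega
  have h3 : (v - 1) % 2 ≤ 1 := by omega
  unfold Standard row midRow
  split_ifs <;>
    simp [blockC, box, List.pairwise_append, List.pairwise_replicate, List.mem_replicate,
      or_imp, forall_and, hiDir, loDir, h2, h3]

lemma length_row {c a x v n d : ℕ} (hx : c ≠ 0 → 0 < x) :
    (row c a x v n d).length = a + x + v + n + d + if c ≤ 1 then 0 else 1 := by
  unfold row midRow
  split_ifs <;> simp [length_blockC] <;> omega

lemma PhiTop_mem_calG {l i j p : ℕ} (hij : i + j ≤ l) (hp : p ≤ j) :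
    PhiTop l i j p ∈ calG l := by
  rw [PhiTop_eq_row hp]
  refine ⟨_, ?_, standard_row.mem_BG2⟩
  rw [length_row (by intro h; simp [h])]
  unfold yy
  split_ifs <;> omega

/-! ### The operator `E_𝒜` on reduced elements -/

lemma mem_calA {l i k j p q r : ℕ} : (⟨i, k, j, p, q, r⟩ : AElt) ∈ calA l ↔
    2 * i ≤ l ∧ i ≤ k ∧ i + k ≤ l ∧ i ≤ j ∧ i + j ≤ l ∧
      p ≤ j ∧ p ≤ q ∧ q ≤ p + k ∧ r + 2 * p ≤ j + q := Iff.rfl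

/-- The elements to which the recursion in the definition of `E_𝒜` does not apply. -/
def Reduced (b : AElt) : Prop := b.k = b.i ∨ b.j = b.i ∨ b.q = b.p ∨ b.p = b.j

/-- `E_𝒜` on reduced elements. -/
def redE (l : ℕ) : AElt → Option AElt
  | ⟨i, k, j, p, q, r⟩ =>
    if i < k ∧ i < j then
      if (q : ℤ) ≤ j - 1 - ((j : ℤ) - k) / 3 then some ⟨i, k - 1, j, p, q, r⟩
      else if i + j < l then some ⟨i, k, j + 1, p + 1, q + 1, r⟩
      else none
    else if k = i then
      if i + 2 ≤ j then
        if (p : ℤ) ≤ j - 1 - ((j : ℤ) - i) / 3 then some ⟨i + 1, k + 1, j - 1, p, q + 1, r⟩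
        else if i + j < l then some ⟨i, k, j + 1, p + 1, q + 1, r⟩
        else none
      else if j = i + 1 then
        if p ≤ i then some ⟨i, k + 1, j - 1, p, q + 1, r⟩
        else if i + j < l then some ⟨i, k, j + 1, p + 1, q + 1, r⟩
        else none
      else
        if p < i then some ⟨i - 1, k + 1, j - 1, p, q + 1, r⟩
        else if i + j < l then some ⟨i, k, j + 1, p + 1, q + 1, r⟩
        else none
    else
      if (q : ℤ) ≤ p - 1 - ((i : ℤ) - k) / 3 then some ⟨i, k - 1, j, p, q, r⟩
      else if p = i then some ⟨i, k, j + 1, p + 1, q + 1, r⟩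
      else some ⟨i - 1, k + 1, j - 1, p, q + 1, r⟩

/-- `E_𝒜` preserves `𝒜`, the reduced elements and `φ₀`, and it raises a weight by one. -/
lemma redE_mem {l : ℕ} {b b' : AElt} (hb : b ∈ calA l) (hr : Reduced b)
    (h : redE l b = some b') :
    b' ∈ calA l ∧ Reduced b' ∧ b'.r = b.r ∧ b'.j + b'.q + 2 * b.p = b.j + b.q + 2 * b'.p ∧
      2 * b'.q + b.k + b.p = 2 * b.q + b'.k + b'.p + 1 := by
  obtain ⟨i, k, j, p, q, r⟩ := b
  rw [mem_calA] at hb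
  simp only [Reduced] at hr
  simp only [redE] at h
  split_ifs at h <;> obtain rfl := Option.some.inj h <;>
    simp only [mem_calA, Reduced, true_and] <;> omega

lemma CA_mk (i k j p q r : ℕ) :
    CA ⟨i, k, j, p, q, r⟩ = ⟨i, j, k, k + p - q, k + j - q, j + q - (2 * p + r)⟩ := rfl

lemma CA_mem {l : ℕ} {b : AElt} (hb : b ∈ calA l) : CA b ∈ calA l := by
  obtain ⟨i, k, j, p, q, r⟩ := b
  rw [mem_calA] at hb
  simp only [CA, mem_calA]
  omega

lemma CA_CA {l : ℕ} {b : AElt} (hb : b ∈ calA l) : CA (CA b) = b := by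
  obtain ⟨i, k, j, p, q, r⟩ := b
  rw [mem_calA] at hb
  simp only [CA, AElt.mk.injEq, true_and]
  omega

lemma CA_reduced {l : ℕ} {b : AElt} (hb : b ∈ calA l) : Reduced (CA b) ↔ Reduced b := by
  obtain ⟨i, k, j, p, q, r⟩ := b
  rw [mem_calA] at hb
  simp only [CA, Reduced]
  omega

set_option maxHeartbeats 1000000 in
/-- `C_𝒜` reverses the arrows of `E_𝒜`. -/
lemma redE_CA {l : ℕ} {b b' : AElt} (hb : b ∈ calA l) (hr : Reduced b)
    (h : redE l b = some b') : redE l (CA b') = some (CA b) := by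
  obtain ⟨i, k, j, p, q, r⟩ := b
  rw [mem_calA] at hb
  simp only [Reduced] at hr
  simp only [redE] at h
  split_ifs at h <;> obtain rfl := Option.some.inj h <;> rw [CA_mk, CA_mk, redE] <;>
    split_ifs <;> first
    | (exfalso; omega)
    | (simp only [Option.some.injEq, AElt.mk.injEq, true_and, and_true]; omega)

/-- A condition satisfied by the elements in which the strings of `E_𝒜` start. The truncated
difference `t.i - t.p` is `(i - p)_+`. -/
def IsStart (l : ℕ) (t : AElt) : Prop :=
  t.i + t.k = l ∧ t.q ≤ yy l t.i t.j + t.j - (t.i - t.p)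

/-- `C_𝒜` maps the end of a string of `E_𝒜` to a start. -/
lemma redE_none {l : ℕ} {b : AElt} (hb : b ∈ calA l) (hr : Reduced b) (h : redE l b = none) :
    IsStart l (CA b) ∧ (b.p = b.j ∨ b.j = b.i → b.p = b.j) := by
  obtain ⟨i, k, j, p, q, r⟩ := b
  rw [mem_calA] at hb
  simp only [Reduced] at hr
  simp only [redE] at h
  simp only [IsStart, CA, yy]
  split_ifs at h <;> omega

/-- The set `p = j` or `j = i` of reduced elements is closed under `E_𝒜`; by `redE_none` its
strings end at `p = j`. -/
lemma redE_edge {l : ℕ} {b b' : AElt} (hb : b ∈ calA l)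
    (hr : b.p = b.j ∨ b.j = b.i) (h : redE l b = some b') : b'.p = b'.j ∨ b'.j = b'.i := by
  obtain ⟨i, k, j, p, q, r⟩ := b
  rw [mem_calA] at hb
  simp only [redE] at h
  simp only at hr
  split_ifs at h <;> obtain rfl := Option.some.inj h <;> simp only <;> omega

/-- A bound for the number of arrows of `E_𝒜` that can be followed from a reduced element; each
arrow lowers it by one. -/
def stringLength (l : ℕ) (b : AElt) : ℕ :=
  l - b.i - b.j + max (b.k + 2 * b.j - 3 * b.q) (b.i + 2 * b.j - 3 * b.p)

lemma redE_stringLength {l : ℕ} {b b' : AElt} (hb : b ∈ calA l) (hr : Reduced b)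
    (h : redE l b = some b') : stringLength l b' + 1 = stringLength l b := by
  obtain ⟨i, k, j, p, q, r⟩ := b
  rw [mem_calA] at hb
  simp only [Reduced] at hr
  simp only [redE] at h
  split_ifs at h <;> obtain rfl := Option.some.inj h <;> simp only [stringLength] <;> omega

/-! ### The operator `E_𝒜` on all elements -/

/-- The passage from level `l - 1` to level `l` for elements in the kernel of `ẽ₀`. -/
def lift (b : AElt) : AElt := ⟨b.i, b.k + 1, b.j + 1, b.p, b.q + 1, b.r⟩

/-- Replacement of the last coordinate, the position in a `0`-string. -/
def setr (r : ℕ) (b : AElt) : AElt := ⟨b.i, b.k, b.j, b.p, b.q, r⟩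

lemma lift_mem {l : ℕ} {b : AElt} (hb : b ∈ calA l) :
    lift b ∈ calA (l + 1) ∧ ¬ Reduced (lift b) := by
  obtain ⟨i, k, j, p, q, r⟩ := b
  rw [mem_calA] at hb
  simp only [lift, mem_calA, Reduced]
  omega

lemma exists_lift_of_not_reduced {l : ℕ} {b : AElt} (hb : b ∈ calA l) (hr : ¬ Reduced b)
    (h0 : b.r = 0) : ∃ l' b', l = l' + 1 ∧ b' ∈ calA l' ∧ b'.r = 0 ∧ b = lift b' := by
  obtain ⟨i, k, j, p, q, r⟩ := b
  rw [mem_calA] at hb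
  simp only [Reduced] at hr
  simp only at h0
  refine ⟨l - 1, ⟨i, k - 1, j - 1, p, q - 1, r⟩, by omega, ?_, h0, ?_⟩
  · rw [mem_calA]; omega
  · simp only [lift, AElt.mk.injEq, true_and, and_true]; omega

lemma iter_f0A {b : AElt} (n : ℕ) (h : b.r + n + 2 * b.p ≤ b.j + b.q) :
    iter f0A n (some b) = some (setr (b.r + n) b) := by
  induction n generalizing b with
  | zero => rfl
  | succ n ih =>
    have h1 : f0A b = some (setr (b.r + 1) b) := by rw [f0A, if_pos (by omega)]; rfl
    rw [iter_succ, Option.bind_some, h1, ih (by simp only [setr]; omega)]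
    simp only [setr]
    rw [Nat.add_right_comm, Nat.add_assoc]

lemma redE_setr (l r : ℕ) (b : AElt) : redE l (setr r b) = (redE l b).map (setr r) := by
  obtain ⟨i, k, j, p, q, r'⟩ := b
  rw [setr, redE, redE]
  split_ifs <;> rfl

lemma EAHigh_of_reduced {l i k j p q : ℕ} (hb : (⟨i, k, j, p, q, 0⟩ : AElt) ∈ calA l)
    (hr : Reduced ⟨i, k, j, p, q, 0⟩) : EAHigh l i k j p q = redE l ⟨i, k, j, p, q, 0⟩ := by
  rw [mem_calA] at hb
  simp only [Reduced] at hr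
  cases l with
  | zero =>
    simp only [EAHigh, redE]
    rw [if_neg (by omega), if_pos (by omega), if_neg (by omega), if_neg (by omega),
      if_neg (by omega), if_neg (by omega)]
  | succ l =>
    simp only [EAHigh, redE]
    by_cases h : i < k ∧ i < j
    · rw [if_pos h, if_pos h, if_pos (by omega)]
    · rw [if_neg h, if_neg h]

/-- The recursive case of `E_𝒜` lifts its value at level `l - 1`. -/
lemma EAHigh_lift {l i k j p q : ℕ} (hik : i ≤ k) (hij : i ≤ j) (hpq : p ≤ q) (hpj : p ≤ j) :
    EAHigh (l + 1) i (k + 1) (j + 1) p (q + 1) = (EAHigh l i k j p q).map lift := by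
  rw [EAHigh, if_pos (by omega), if_neg (by omega)]
  simp only [Nat.add_sub_cancel]
  cases EAHigh l i k j p q with
  | none => rfl
  | some c => simp [e0A, raise, lift]

lemma EAHigh_mem {l : ℕ} {b c : AElt} (hb : b ∈ calA l) (h0 : b.r = 0)
    (h : EAHigh l b.i b.k b.j b.p b.q = some c) :
    c ∈ calA l ∧ c.r = 0 ∧ c.j + c.q + 2 * b.p = b.j + b.q + 2 * c.p ∧
      (Reduced c ↔ Reduced b) := by
  induction l generalizing b c with
  | zero => simp [EAHigh] at h
  | succ l ih =>
    by_cases hr : Reduced b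
    · obtain ⟨i, k, j, p, q, r⟩ := b
      obtain rfl : r = 0 := h0
      rw [EAHigh_of_reduced hb hr] at h
      obtain ⟨h1, h2, h3, h4, -⟩ := redE_mem hb hr h
      exact ⟨h1, h3, h4, iff_of_true h2 hr⟩
    · obtain ⟨l', b', hl, hb', h0', rfl⟩ := exists_lift_of_not_reduced hb hr h0
      obtain rfl : l = l' := by omega
      have hb'' := hb'
      obtain ⟨i, k, j, p, q, r⟩ := b'
      rw [mem_calA] at hb''
      simp only [lift] at h
      rw [EAHigh_lift (by omega) (by omega) (by omega) (by omega)] at h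
      obtain ⟨c', hc', rfl⟩ := Option.map_eq_some_iff.1 h
      obtain ⟨h1, h2, h3, -⟩ := ih hb' h0' hc'
      refine ⟨(lift_mem h1).1, h2, ?_, iff_of_false (lift_mem h1).2 hr⟩
      simp only [lift] at h3 ⊢
      omega

lemma setr_mem {l r : ℕ} {b : AElt} (hb : b ∈ calA l) (hr : r + 2 * b.p ≤ b.j + b.q) :
    setr r b ∈ calA l :=
  ⟨hb.1, hb.2.1, hb.2.2.1, hb.2.2.2.1, hb.2.2.2.2.1, hb.2.2.2.2.2.1, hb.2.2.2.2.2.2.1,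
    hb.2.2.2.2.2.2.2.1, hr⟩

lemma r_le {l : ℕ} {b : AElt} (hb : b ∈ calA l) : b.r + 2 * b.p ≤ b.j + b.q :=
  hb.2.2.2.2.2.2.2.2

/-- `E_𝒜` does not change the position in `0`-strings. -/
lemma EA_eq_map {l : ℕ} {b : AElt} (hb : b ∈ calA l) :
    EA l b = (EAHigh l b.i b.k b.j b.p b.q).map (setr b.r) := by
  unfold EA
  cases h : EAHigh l b.i b.k b.j b.p b.q with
  | none => simp
  | some c =>
    have hle := r_le hb
    obtain ⟨-, h2, h3, -⟩ :=
      EAHigh_mem (b := setr 0 b) (setr_mem hb (by omega)) rfl h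
    simp only [setr] at h3
    rw [iter_f0A _ (by omega), h2, Nat.zero_add, Option.map_some]

lemma EA_setr {l r : ℕ} {b : AElt} (hb : b ∈ calA l) (hr : r + 2 * b.p ≤ b.j + b.q) :
    EA l (setr r b) = (EA l b).map (setr r) := by
  rw [EA_eq_map hb, EA_eq_map (setr_mem hb hr), Option.map_map]
  rfl

lemma EA_mem {l : ℕ} {b b' : AElt} (hb : b ∈ calA l) (h : EA l b = some b') :
    b' ∈ calA l ∧ b'.r = b.r ∧ b'.j + b'.q + 2 * b.p = b.j + b.q + 2 * b'.p ∧
      (Reduced b' ↔ Reduced b) := by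
  rw [EA_eq_map hb] at h
  obtain ⟨c, hc, rfl⟩ := Option.map_eq_some_iff.1 h
  have hle := r_le hb
  obtain ⟨h1, -, h3, h4⟩ := EAHigh_mem (b := setr 0 b) (setr_mem hb (by omega)) rfl hc
  simp only [setr] at h3
  exact ⟨setr_mem h1 (by omega), rfl, h3, h4⟩

lemma EA_of_reduced {l : ℕ} {b : AElt} (hb : b ∈ calA l) (hr : Reduced b) :
    EA l b = redE l b := by
  have hle := r_le hb
  have hb0 : setr 0 b ∈ calA l := setr_mem hb (by omega)
  rw [EA_eq_map hb, EAHigh_of_reduced hb0 hr]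
  exact (redE_setr l b.r (setr 0 b)).symm

lemma EA_lift {l : ℕ} {b : AElt} (hb : b ∈ calA l) :
    EA (l + 1) (lift b) = (EA l b).map lift := by
  rw [EA_eq_map hb, EA_eq_map (lift_mem hb).1]
  obtain ⟨h1, h2, h3, h4, h5, h6, h7, h8, h9⟩ := hb
  simp only [lift]
  rw [EAHigh_lift h2 h4 h7 h6, Option.map_map, Option.map_map]
  rfl

lemma iter_EA_mem {l m : ℕ} {b b' : AElt} (hb : b ∈ calA l)
    (h : iter (EA l) m (some b) = some b') :
    b' ∈ calA l ∧ b'.r = b.r ∧ b'.j + b'.q + 2 * b.p = b.j + b.q + 2 * b'.p ∧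
      (Reduced b' ↔ Reduced b) := by
  refine iter_invariant (fun c => c ∈ calA l ∧ c.r = b.r ∧
    c.j + c.q + 2 * b.p = b.j + b.q + 2 * c.p ∧ (Reduced c ↔ Reduced b)) ?_ m
    ⟨hb, rfl, rfl, Iff.rfl⟩ h
  rintro x y ⟨hx1, hx2, hx3, hx4⟩ hy
  obtain ⟨hy1, hy2, hy3, hy4⟩ := EA_mem hx1 hy
  exact ⟨hy1, hy2.trans hx2, by omega, hy4.trans hx4⟩

lemma iter_EA_lift {l m : ℕ} {b : AElt} (hb : b ∈ calA l) :
    iter (EA (l + 1)) m (some (lift b)) = (iter (EA l) m (some b)).map lift := by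
  induction m generalizing b with
  | zero => rfl
  | succ m ih =>
    rw [iter_succ, iter_succ, Option.bind_some, Option.bind_some, EA_lift hb]
    cases h : EA l b with
    | none => simp
    | some c =>
      exact ih (EA_mem hb h).1

lemma iter_EA_setr {l m r : ℕ} {b : AElt} (hb : b ∈ calA l) (hr : r + 2 * b.p ≤ b.j + b.q) :
    iter (EA l) m (some (setr r b)) = (iter (EA l) m (some b)).map (setr r) := by
  induction m generalizing b with
  | zero => rfl
  | succ m ih =>
    rw [iter_succ, iter_succ, Option.bind_some, Option.bind_some, EA_setr hb hr]
    cases h : EA l b with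
    | none => simp
    | some c =>
      obtain ⟨h1, -, h3, -⟩ := EA_mem hb h
      exact ih h1 (by omega)

/-! ### The strings of `E_𝒜` -/

lemma iter_EA_CA {l m : ℕ} {b b' : AElt} (hb : b ∈ calA l) (hr : Reduced b)
    (h : iter (EA l) m (some b) = some b') : iter (EA l) m (some (CA b')) = some (CA b) := by
  refine iter_reverse CA (fun c => c ∈ calA l ∧ Reduced c) ?_ ?_ m ⟨hb, hr⟩ h
  · rintro x y ⟨hx, hxr⟩ hy
    obtain ⟨h1, -, -, h4⟩ := EA_mem hx hy
    exact ⟨h1, h4.2 hxr⟩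
  · rintro x y ⟨hx, hxr⟩ hy
    obtain ⟨h1, -, -, h4⟩ := EA_mem hx hy
    rw [EA_of_reduced (CA_mem h1) ((CA_reduced h1).2 (h4.2 hxr))]
    rw [EA_of_reduced hx hxr] at hy
    exact redE_CA hx hxr hy

lemma iter_EA_edge {l m : ℕ} {b b' : AElt} (hb : b ∈ calA l) (hr : b.p = b.j ∨ b.j = b.i)
    (h : iter (EA l) m (some b) = some b') : b'.p = b'.j ∨ b'.j = b'.i := by
  refine (iter_invariant (fun c => c ∈ calA l ∧ (c.p = c.j ∨ c.j = c.i)) ?_ m ⟨hb, hr⟩ h).2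
  rintro x y ⟨hx, hxz⟩ hy
  refine ⟨(EA_mem hx hy).1, ?_⟩
  rw [EA_of_reduced hx (by unfold Reduced; omega)] at hy
  exact redE_edge hx hxz hy

/-- The length of a string of `E_𝒜`, read off from its ends. -/
lemma iter_EA_weight {l m : ℕ} {b b' : AElt} (hb : b ∈ calA l) (hr : Reduced b)
    (h : iter (EA l) m (some b) = some b') :
    2 * b'.q + b.k + b.p = 2 * b.q + b'.k + b'.p + m := by
  induction m generalizing b with
  | zero => obtain rfl := Option.some.inj h; rfl
  | succ m ih =>
    obtain ⟨c, hc, h⟩ := iter_succ_eq_some.1 h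
    obtain ⟨h1, -, -, h4⟩ := EA_mem hb hc
    have := ih h1 (h4.2 hr) h
    rw [EA_of_reduced hb hr] at hc
    have := (redE_mem hb hr hc).2.2.2.2
    omega

lemma exists_string_end {l : ℕ} {b : AElt} (hb : b ∈ calA l) (hr : Reduced b) :
    ∃ m e, iter (EA l) m (some b) = some e ∧ EA l e = none := by
  induction hn : stringLength l b generalizing b with
  | zero =>
    refine ⟨0, b, rfl, ?_⟩
    rw [EA_of_reduced hb hr]
    cases h : redE l b with
    | none => rfl
    | some c => have := redE_stringLength hb hr h; omega
  | succ n ih =>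
    cases h : EA l b with
    | none => exact ⟨0, b, rfl, h⟩
    | some c =>
      obtain ⟨h1, -, -, h4⟩ := EA_mem hb h
      rw [EA_of_reduced hb hr] at h
      have := redE_stringLength hb hr h
      obtain ⟨m, e, hm, he⟩ := ih h1 (h4.2 hr) (by omega)
      exact ⟨m + 1, e, iter_succ_eq_some.2 ⟨c, by rw [EA_of_reduced hb hr, h], hm⟩, he⟩

/-- Every reduced element lies on a string from a start. If the string through `C_𝒜 b` meets the
set `p = j` or `j = i`, then the start of the string through `b` has `q = p`. -/
lemma exists_start_of_reduced {l : ℕ} {b : AElt} (hb : b ∈ calA l) (hr : Reduced b) :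
    ∃ m t, t ∈ calA l ∧ Reduced t ∧ IsStart l t ∧ t.r = b.r ∧
      iter (EA l) m (some t) = some b ∧
      ((CA b).p = (CA b).j ∨ (CA b).j = (CA b).i → t.q = t.p) := by
  have hb' := CA_mem hb
  have hr' := (CA_reduced hb).2 hr
  obtain ⟨m, e, hm, he⟩ := exists_string_end hb' hr'
  obtain ⟨h1, h2, h3, h4⟩ := iter_EA_mem hb' hm
  have her := h4.2 hr'
  have he' := he
  rw [EA_of_reduced h1 her] at he'
  obtain ⟨hs, hz⟩ := redE_none h1 her he'
  have hback := iter_EA_CA hb' hr' hm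
  rw [CA_CA hb] at hback
  have hmem := CA_mem h1
  refine ⟨m, CA e, hmem, (CA_reduced h1).2 her, hs, (iter_EA_mem hmem hback).2.1.symm, hback,
    fun h => ?_⟩
  have hpj := hz (iter_EA_edge hb' h hm)
  simp only [CA, hpj]

lemma IsStart.lift {l : ℕ} {t : AElt} (hmem : t ∈ calA l) (ht : IsStart l t) :
    IsStart (l + 1) (lift t) := by
  obtain ⟨i, k, j, p, q, r⟩ := t
  rw [mem_calA] at hmem
  simp only [IsStart, G2Crystal.lift, yy] at ht ⊢
  omega

lemma exists_start {l : ℕ} {b : AElt} (hb : b ∈ calA l) (h0 : b.r = 0) :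
    ∃ m t, t ∈ calA l ∧ IsStart l t ∧ iter (EA l) m (some t) = some b := by
  induction l generalizing b with
  | zero =>
    have hr : Reduced b := by
      obtain ⟨i, k, j, p, q, r⟩ := b
      rw [mem_calA] at hb
      simp only [Reduced]
      omega
    obtain ⟨m, t, h1, -, h3, -, h5, -⟩ := exists_start_of_reduced hb hr
    exact ⟨m, t, h1, h3, h5⟩
  | succ l ih =>
    by_cases hr : Reduced b
    · obtain ⟨m, t, h1, -, h3, -, h5, -⟩ := exists_start_of_reduced hb hr
      exact ⟨m, t, h1, h3, h5⟩
    · obtain ⟨l', b', hl, hb', h0', rfl⟩ := exists_lift_of_not_reduced hb hr h0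
      obtain rfl : l = l' := by omega
      obtain ⟨m, t, h1, h2, h3⟩ := ih hb' h0'
      refine ⟨m, lift t, (lift_mem h1).1, h2.lift h1, ?_⟩
      rw [iter_EA_lift h1, h3, Option.map_some]

lemma le_stringLength {l m : ℕ} {b b' : AElt} (hb : b ∈ calA l) (hr : Reduced b)
    (h : iter (EA l) m (some b) = some b') : m ≤ stringLength l b := by
  induction m generalizing b with
  | zero => exact Nat.zero_le _
  | succ m ih =>
    obtain ⟨c, hc, h⟩ := iter_succ_eq_some.1 h
    obtain ⟨h1, -, -, h4⟩ := EA_mem hb hc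
    rw [EA_of_reduced hb hr] at hc
    have := redE_stringLength hb hr hc
    have := ih h1 (h4.2 hr) h
    omega

/-- The bound `2(l - i) + j - 3q` for the length of the string from a start. -/
lemma length_string_le {l m : ℕ} {t b : AElt} (ht : t ∈ calA l) (hs : IsStart l t)
    (hr : Reduced t ∨ t.r = 0) (h : iter (EA l) m (some t) = some b) :
    m + 3 * t.q + 2 * t.i ≤ 2 * l + t.j := by
  induction l generalizing t b with
  | zero =>
    obtain ⟨i, k, j, p, q, r⟩ := t
    have ht' := ht
    rw [mem_calA] at ht'
    have := le_stringLength ht (by simp only [Reduced]; omega) h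
    simp only [stringLength] at this ⊢
    omega
  | succ l ih =>
    by_cases hr' : Reduced t
    · have := le_stringLength ht hr' h
      obtain ⟨i, k, j, p, q, r⟩ := t
      rw [mem_calA] at ht
      simp only [Reduced, IsStart, yy, stringLength] at hr' hs this ⊢
      omega
    · obtain ⟨l', t', hl, ht', h0', rfl⟩ :=
        exists_lift_of_not_reduced ht hr' (hr.resolve_left hr')
      obtain rfl : l = l' := by omega
      rw [iter_EA_lift ht'] at h
      obtain ⟨b', hb', rfl⟩ := Option.map_eq_some_iff.1 h
      have := ih ht' (by
        obtain ⟨i, k, j, p, q, r⟩ := t'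
        rw [mem_calA] at ht'
        simp only [IsStart, G2Crystal.lift, yy] at hs ⊢
        omega) (Or.inr h0') hb'
      simp only [G2Crystal.lift]
      omega

/-! ### Strings with both ends in `B_C` -/

/-- The elements on the string of `E_𝒜` from `f̃₁^q f̃₀^q h^{l,i}_{(l-i,j)}`, up to the position in
`0`-strings. If `q = j`, the string lowers `k` to `j` and then raises `j`. If `q < j`, it lowers
`k` to `i`, then raises `i = k` and lowers `j` until `i` and `j` meet, then lowers `i = j` to `q`,
and finally raises `j`; the last two alternatives describe the elements where it has left this path
and raises `j` to the end, with `p < j`. -/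
def OnPath (i₀ j₀ q₀ : ℕ) (b : AElt) : Prop :=
  (q₀ = j₀ ∧ b.i = i₀ ∧ b.p = b.q ∧ b.p = b.j ∧ (b.j = j₀ ∧ j₀ ≤ b.k ∨ b.k = j₀ ∧ j₀ ≤ b.j)) ∨
    q₀ < j₀ ∧
      ((b.i = i₀ ∧ b.p = q₀ ∧ b.q = q₀ ∧ b.j = j₀) ∨
        (b.k = b.i ∧ b.i + b.j = i₀ + j₀ ∧ b.p = q₀ ∧ b.q + i₀ = q₀ + b.i ∧
          (b.p < b.j ∨ b.j = b.i)) ∨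
        (b.j = b.i ∧ b.p = q₀ ∧ b.i + b.k = i₀ + j₀ ∧ b.q + b.i = q₀ + j₀) ∨
        (b.i = q₀ ∧ b.k + q₀ = i₀ + j₀ ∧ b.p = b.j ∧ b.q + q₀ = j₀ + b.j) ∨
        (b.p < b.j ∧ b.i < b.k ∧ b.i < b.j ∧ b.p = b.q ∧ (b.j : ℤ) - ((b.j : ℤ) - b.k) / 3 ≤ b.q) ∨
        (b.p < b.j ∧ b.k = b.i ∧ b.i + 2 ≤ b.j ∧ (b.j : ℤ) - ((b.j : ℤ) - b.i) / 3 ≤ b.p))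

set_option maxHeartbeats 1000000 in
lemma OnPath.redE {l i₀ j₀ q₀ : ℕ} {b b' : AElt} (hij : i₀ ≤ j₀) (hb : b ∈ calA l)
    (hp : OnPath i₀ j₀ q₀ b) (h : redE l b = some b') : OnPath i₀ j₀ q₀ b' := by
  obtain ⟨i, k, j, p, q, r⟩ := b
  rw [mem_calA] at hb
  simp only [OnPath] at hp
  simp only [G2Crystal.redE] at h
  rcases hp with hp | ⟨h0, hp | hp | hp | hp | hp | hp⟩ <;> split_ifs at h <;>
    first
    | (exfalso; omega)
    | (obtain rfl := Option.some.inj h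
       simp only [OnPath]
       first
       | (left; omega)
       | (refine Or.inr ⟨h0, ?_⟩
          first
          | (left; omega)
          | (right; left; omega)
          | (right; right; left; omega)
          | (right; right; right; left; omega)
          | (right; right; right; right; left; omega)
          | (right; right; right; right; right; omega)))

/-- The two possibilities for a string from `t` in `B_C` whose image under `C_𝒜` starts at `t'` in
`B_C`: either `(i, j, q)` is exchanged with `(q, i + j - q, i)`, or `q = j` and `(i, j, q)` is
unchanged. The last equation determines the length of the string. -/
lemma string_between_BC {l m : ℕ} {t t' : AElt} (ht : t ∈ calA l) (hk : t.i + t.k = l)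
    (hq : t.q = t.p) (ht' : t' ∈ calA l) (hk' : t'.i + t'.k = l) (hq' : t'.q = t'.p)
    (h : iter (EA l) m (some t) = some (CA t')) :
    (t'.i = t.q ∧ t'.j + t.q = t.i + t.j ∧ t'.q = t.i ∨
      t'.i = t.i ∧ t'.j = t.j ∧ t'.q = t.q ∧ t.q = t.j) ∧
    t'.r + t.r + t.q = t.j ∧ m + 3 * t.q + 2 * t.i = 2 * l + t.j := by
  have hr : Reduced t := Or.inr (Or.inr (Or.inl hq))
  have hij : t.i ≤ t.j := ht.2.2.2.1
  obtain ⟨-, h2, h3, -⟩ := iter_EA_mem ht h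
  obtain ⟨⟨-, -⟩, h4⟩ := iter_invariant
    (fun c => (c ∈ calA l ∧ Reduced c) ∧ OnPath t.i t.j t.q c) (by
      rintro x y ⟨⟨hx, hxr⟩, hxp⟩ hy
      obtain ⟨g1, -, -, g4⟩ := EA_mem hx hy
      rw [EA_of_reduced hx hxr] at hy
      exact ⟨⟨g1, g4.2 hxr⟩, hxp.redE hij hx hy⟩) m
    ⟨⟨ht, hr⟩, by
      obtain ⟨g1, g2, g3, g4, g5, g6, -⟩ := ht
      simp only [OnPath, true_and, and_true]; omega⟩ h
  have h5 := iter_EA_weight ht hr h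
  obtain ⟨i, k, j, p, q, r⟩ := t
  obtain ⟨i', k', j', p', q', r'⟩ := t'
  rw [mem_calA] at ht ht'
  simp only [CA, OnPath] at *
  omega

/-! ### The tableaux of `B_C` and `B_R` -/

lemma iter_wordF_PhiTop {l i j p q : ℕ} (hij : i ≤ j) (hp : p ≤ j)
    (hq : q ≤ yy l i j + j - (i - p)) :
    iter (wordF i1) q (some (PhiTop l i j p)) =
      some (row ((l - i - j) % 3) (min p i)
        (yy l i j + (p - i) + (if (l - i - j) % 3 = 0 then 0 else 1) -
          (q - (j - (p - i) - (i - p))))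
        (yy l i j + (i - p) + (q - (j - (p - i) - (i - p))))
        (yy l i j + j - (p - i) - min q (j - (p - i) - (i - p)))
        (min q (j - (p - i) - (i - p)))) := by
  rw [PhiTop_eq_row hp, iter_wordF_i1_row (by omega) (by omega)]
  rw [show yy l i j + j - (p - i) - (yy l i j + (i - p)) = j - (p - i) - (i - p) by omega]

lemma row_congr {c a x v n d a' x' v' n' d' : ℕ} (ha : a = a') (hx : x = x') (hv : v = v')
    (hn : n = n') (hd : d = d') : row c a x v n d = row c a' x' v' n' d' := by
  subst_vars; rfl

/-- The highest element of the `2`-string through `f̃₁^q Φ(f̃₀^p h)`. -/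
lemma iter_wordE_PhiTop {l i j p q K : ℕ} {u : Word} (hij : i ≤ j) (hl : i + j ≤ l) (hp : p ≤ j)
    (hq : q ≤ yy l i j + j - (i - p)) (hK : K + 3 * q + 2 * i = 2 * l + j)
    (hu : iter (wordF i1) q (some (PhiTop l i j p)) = some u) :
    iter (wordE i2) K (some u) = some (CG (row ((l - i - j) % 3)
      (min q (j - (p - i) - (i - p)))
      (yy l i j + j - (p - i) - min q (j - (p - i) - (i - p)) +
        if (l - i - j) % 3 = 0 then 0 else 1)
      (yy l i j + (i - p) + (q - (j - (p - i) - (i - p))))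
      (yy l i j + (p - i) - (q - (j - (p - i) - (i - p)))) (min p i))) := by
  rw [iter_wordF_PhiTop hij hp hq] at hu
  obtain rfl := Option.some.inj hu
  have hy : 3 * yy l i j + (l - i - j) % 3 = l - i - j := by unfold yy; omega
  have hc : (l - i - j) % 3 < 3 := Nat.mod_lt _ (by omega)
  generalize yy l i j = y at hq hy ⊢
  generalize (l - i - j) % 3 = c at hy hc ⊢
  obtain ⟨s, hs⟩ : ∃ s, s = q - (j - (p - i) - (i - p)) := ⟨_, rfl⟩
  obtain ⟨g, hg⟩ : ∃ g, g = min q (j - (p - i) - (i - p)) := ⟨_, rfl⟩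
  obtain ⟨n, hn⟩ : ∃ n, n = y + j - (p - i) - g := ⟨_, rfl⟩
  rw [← hs, ← hg, ← hn]
  have hsx : s ≤ y + (p - i) := by omega
  have hsum : y + (p - i) + n + q = 2 * y + j + s := by omega
  generalize p - i = e at hsx hsum ⊢
  have hx : y + e - s = y + e + (if c = 0 then 0 else 1) - s - if c = 0 then 0 else 1 := by
    split_ifs <;> omega
  rw [hx]
  refine iter_wordE_i2_row _ _ _ K hc (fun h => ?_) ?_
  · rw [if_neg h]; omega
  · obtain rfl | rfl | rfl : c = 0 ∨ c = 1 ∨ c = 2 := by omega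
    · simp only [if_true]; omega
    · simp only [one_ne_zero, if_true, if_false]; omega
    · simp only [OfNat.ofNat_ne_zero, OfNat.ofNat_ne_one, if_false]; omega

/-- The identity `Φ(C_𝒜 t) = C_𝒢 Φ(t)` for the highest elements of `2`-strings. -/
lemma iter_wordE_PhiTop_eq_CG {l i j p q i' j' p' q' K : ℕ} {u u' : Word} (hij : i ≤ j)
    (hl : i + j ≤ l) (hqp : q ≤ p) (hp : p ≤ j) (hij' : i' ≤ j') (hqp' : q' ≤ p') (hp' : p' ≤ j')
    (hK : K + 3 * q + 2 * i = 2 * l + j)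
    (h : i' = q ∧ j' + q = i + j ∧ q' = i ∧ p' + p = i + j ∨
      i' = i ∧ j' = j ∧ q' = q ∧ q = j ∧ p' = p)
    (hu : iter (wordF i1) q (some (PhiTop l i j p)) = some u)
    (hu' : iter (wordF i1) q' (some (PhiTop l i' j' p')) = some u') :
    iter (wordE i2) K (some u) = some (CG u') := by
  rw [iter_wordE_PhiTop hij hl hp (by omega) hK hu]
  rw [iter_wordF_PhiTop hij' hp' (by omega)] at hu'
  obtain rfl := Option.some.inj hu'
  have hs : l - i' - j' = l - i - j := by omega
  have hy : yy l i' j' = yy l i j := by rw [yy, yy, hs]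
  rw [hs, hy]
  refine congrArg some (congrArg CG ?_)
  clear hu hK hs hy
  generalize yy l i j = y
  generalize (l - i - j) % 3 = c
  generalize (if c = 0 then 0 else 1) = δ
  rcases h with ⟨rfl, h1, rfl, h2⟩ | ⟨rfl, rfl, rfl, rfl, rfl⟩
  · rcases Nat.le_total p q' with h | h
    · have e1 : p - q' = 0 := by omega
      have e2 : i' - (j' - (p' - i') - (i' - p')) = 0 := by omega
      have e3 : i' - p' = 0 := by omega
      rw [e1, e3]
      apply row_congr <;> omega
    · have e1 : q' - p = 0 := by omega
      rw [e1]
      rcases Nat.le_total p' i' with h3 | h3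
      · have e3 : p' - i' = 0 := by omega
        rw [e3]
        apply row_congr <;> omega
      · have e3 : i' - p' = 0 := by omega
        rw [e3]
        apply row_congr <;> omega
  · obtain rfl : p' = q' := by omega
    have e1 : i' - p' = 0 := by omega
    rw [e1]
    apply row_congr <;> omega

/-! ### The sets `𝒜^{(l)}`, `B_C`, `B_R`, `B_W`, `B_U` in coordinates -/

lemma f1f0_eq {i k j p q : ℕ} (hp : p ≤ j) (hq : q ≤ p + k) :
    f1f0 i k j p q = some ⟨i, k, j, min p q, q, p - q⟩ := by
  have h0 : iter f0A p (some (hw i k j)) = some ⟨i, k, j, 0, 0, p⟩ := by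
    rw [iter_f0A p (by simp only [hw]; omega)]
    simp only [hw, setr, Nat.zero_add]
  rw [f1f0, h0]
  induction q with
  | zero => simp
  | succ q ih =>
    rw [iter_succ', ih (by omega), Option.bind_some, f1A]
    dsimp only
    split_ifs
    · simp only [Option.some.injEq, AElt.mk.injEq, true_and]; omega
    · omega
    · simp only [Option.some.injEq, AElt.mk.injEq, true_and]; omega
    · omega

lemma iter_e1A_e0A_lw {i k j p q : ℕ} (hp : p ≤ k) (hq : q ≤ p + j) :
    iter e1A q (iter e0A p (some (lw i k j))) =
      some ⟨i, k, j, j - (q - p), k + j - q, k - p + (q - p)⟩ := by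
  have h0 : iter e0A p (some (lw i k j)) = some ⟨i, k, j, j, k + j, k - p⟩ := by
    clear hq
    induction p with
    | zero => rfl
    | succ p ih =>
      rw [iter_succ', ih (by omega), Option.bind_some, e0A, if_pos (by dsimp only; omega)]
      rfl
  rw [h0]
  induction q with
  | zero => simp
  | succ q ih =>
    rw [iter_succ', ih (by omega), Option.bind_some, e1A]
    dsimp only
    split_ifs
    · simp only [Option.some.injEq, AElt.mk.injEq, true_and]; omega
    · simp only [Option.some.injEq, AElt.mk.injEq, true_and]; omega
    · omega

lemma mem_calAl {l : ℕ} {b : AElt} : b ∈ calAl l ↔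
    b ∈ calA l ∧ (Reduced b ∨ b.r = 0 ∨ b.r + 2 * b.p = b.j + b.q) := by
  obtain ⟨i, k, j, p, q, r⟩ := b
  constructor
  · rintro ⟨hb, h | h | ⟨p', q', hp', hq', h⟩ | ⟨p', q', hp', hq', h⟩⟩ <;> refine ⟨hb, ?_⟩
    · exact Or.inl (Or.inr (Or.inl h))
    · exact Or.inl (Or.inl h)
    · rw [f1f0_eq hp' hq', Option.some.injEq, AElt.mk.injEq] at h
      simp only [Reduced]
      omega
    · rw [iter_e1A_e0A_lw hp'.le hq', Option.some.injEq, AElt.mk.injEq] at h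
      rw [mem_calA] at hb
      simp only [Reduced]
      dsimp only at hp' hq'
      omega
  · rintro ⟨hb, h⟩
    refine ⟨hb, ?_⟩
    rw [mem_calA] at hb
    simp only [Reduced] at h
    dsimp only
    by_cases h1 : j = i
    · exact Or.inl h1
    by_cases h2 : k = i
    · exact Or.inr (Or.inl h2)
    by_cases h3 : q = p ∨ r = 0
    · refine Or.inr (Or.inr (Or.inl ⟨p + r, q, by omega, by omega, ?_⟩))
      rw [f1f0_eq (by omega) (by omega), Option.some.injEq, AElt.mk.injEq]
      omega
    · refine Or.inr (Or.inr (Or.inr ⟨k + j - (p + r), k + j - q, by omega, by omega, ?_⟩))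
      rw [iter_e1A_e0A_lw (by omega) (by omega), Option.some.injEq, AElt.mk.injEq]
      omega

lemma CA_mem_calAl {l : ℕ} {b : AElt} (hb : b ∈ calAl l) : CA b ∈ calAl l := by
  rw [mem_calAl] at hb ⊢
  refine ⟨CA_mem hb.1, ?_⟩
  rw [CA_reduced hb.1]
  obtain ⟨i, k, j, p, q, r⟩ := b
  obtain ⟨hb, h⟩ := hb
  rw [mem_calA] at hb
  refine h.imp_right fun h => ?_
  simp only [CA] at h ⊢
  omega

lemma mem_BC {l : ℕ} {t : AElt} : t ∈ BC l ↔ t ∈ calA l ∧ t.i + t.k = l ∧ t.q = t.p := by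
  obtain ⟨i, k, j, p, q, r⟩ := t
  constructor
  · rintro ⟨i', j', p', q', h1, h2, h3, h4, h5, h⟩
    rw [f1f0_eq h5 (by omega), Option.some.injEq, AElt.mk.injEq] at h
    rw [mem_calA]
    dsimp only
    omega
  · rintro ⟨h, h1, h2⟩
    rw [mem_calA] at h
    dsimp only at h1 h2
    refine ⟨i, j, p + r, q, by omega, by omega, by omega, by omega, by omega, ?_⟩
    rw [f1f0_eq (by omega) (by omega), Option.some.injEq, AElt.mk.injEq]
    omega

lemma mem_BR {l : ℕ} {t : AElt} :
    t ∈ BR l ↔ t ∈ calA l ∧ IsStart l t ∧ ¬ Reduced t ∧ t.r = 0 := by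
  obtain ⟨i, k, j, p, q, r⟩ := t
  constructor
  · rintro ⟨i', j', p', q', h1, h2, h3, h4, h5, h6, h⟩
    have hy : 3 * yy l i' j' ≤ l - i' - j' := by unfold yy; omega
    rw [f1f0_eq h4.le (by omega), Option.some.injEq, AElt.mk.injEq] at h
    obtain ⟨rfl, rfl, rfl, rfl, rfl, rfl⟩ := h
    rw [mem_calA]
    simp only [IsStart, Reduced]
    rw [Nat.min_eq_left h5.le]
    omega
  · rintro ⟨h, ⟨h1, h2⟩, h3, h4⟩
    rw [mem_calA] at h
    simp only [Reduced] at h1 h2 h3 h4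
    refine ⟨i, j, p, q, by omega, by omega, by omega, by omega, by omega, h2, ?_⟩
    rw [f1f0_eq (by omega) (by omega), Option.some.injEq, AElt.mk.injEq]
    omega

lemma mem_BW_union_BU {l : ℕ} {t : AElt} (ht : t ∈ calA l) (hr : Reduced t) (hs : IsStart l t)
    (hq : t.q ≠ t.p) (h0 : t.r = 0) : t ∈ BW l ∪ BU l := by
  obtain ⟨i, k, j, p, q, r⟩ := t
  rw [mem_calA] at ht
  obtain ⟨h1, h2⟩ := hs
  simp only [Reduced] at h1 h2 hr hq h0
  by_cases h : j = i
  · subst h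
    refine Or.inl ⟨j, p, q, by omega, by omega, by omega, by omega, ?_⟩
    rw [f1f0_eq (by omega) (by omega), Option.some.injEq, AElt.mk.injEq]
    omega
  · refine Or.inr ⟨i, j, q, by omega, by omega, by omega, by omega, by omega, ?_⟩
    rw [f1f0_eq (by omega) (by omega), Option.some.injEq, AElt.mk.injEq]
    omega

lemma IsStart.of_mem_BC {l : ℕ} {t : AElt} (ht : t ∈ BC l) : IsStart l t := by
  obtain ⟨h, h1, h2⟩ := mem_BC.1 ht
  obtain ⟨i, k, j, p, q, r⟩ := t
  rw [mem_calA] at h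
  simp only [IsStart] at h1 h2 ⊢
  omega

/-- The coordinates common to the elements of `B_C` and `B_R`. -/
lemma mem_BC_union_BR {l : ℕ} {t : AElt} (ht : t ∈ BC l ∪ BR l) :
    t ∈ calA l ∧ IsStart l t ∧ (Reduced t ∨ t.r = 0) ∧ (t.q = t.p ∨ t.r = 0 ∧ t.p ≤ t.q) := by
  rcases ht with ht | ht
  · obtain ⟨h, h1, h2⟩ := mem_BC.1 ht
    exact ⟨h, .of_mem_BC ht, Or.inl (Or.inr (Or.inr (Or.inl h2))), Or.inl h2⟩
  · obtain ⟨h, h1, h2, h3⟩ := mem_BR.1 ht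
    exact ⟨h, h1, Or.inr h3, Or.inr ⟨h3, h.2.2.2.2.2.2.1⟩⟩

/-! ### The strings of `Φ` -/

lemma PhiStart_iff {l : ℕ} {t : AElt} {u : Word} (ht : t ∈ BC l ∪ BR l) : PhiStart l t u ↔
    iter (wordF i1) t.q (some (PhiTop l t.i t.j (t.p + t.r))) = some u := by
  obtain ⟨h, ⟨hs1, hs2⟩, -, h3⟩ := mem_BC_union_BR ht
  constructor
  · rintro ⟨i, j, p, q, h1, h2, h4, h5, h6, h7, h8⟩
    have hy : 3 * yy l i j ≤ l - i - j := by unfold yy; omega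
    rw [f1f0_eq h5 (by omega), Option.some.injEq] at h7
    subst h7
    dsimp only
    rwa [show min p q + (p - q) = p by omega]
  · intro hu
    obtain ⟨i, k, j, p, q, r⟩ := t
    rw [mem_calA] at h
    dsimp only at h3 hs1 hs2 hu
    refine ⟨i, j, p + r, q, by omega, by omega, by omega, by omega, by omega, ?_, hu⟩
    rw [f1f0_eq (by omega) (by omega), Option.some.injEq, AElt.mk.injEq]
    omega

/-- `Φ` is defined on the strings from `B_C ∪ B_R`: the `2`-string through `Φ(t)` is at least as
long as the string of `E_𝒜` from `t`. -/
lemma exists_PhiString {l : ℕ} {b : AElt} (hb : b ∈ strCR l) : ∃ w, PhiString l b w := by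
  obtain ⟨t, ht, m, hm⟩ := hb
  obtain ⟨h, hs, hr, h3⟩ := mem_BC_union_BR ht
  have hlen := length_string_le h hs hr hm
  obtain ⟨hs1, hs2⟩ := hs
  obtain ⟨g1, g2, g3, g4, g5, g6, g7, g8, g9⟩ := h
  have hp : t.p + t.r ≤ t.j := by omega
  have hq : t.q ≤ yy l t.i t.j + t.j - (t.i - (t.p + t.r)) := by omega
  have hu := iter_wordF_PhiTop g4 hp hq
  have hy : 3 * yy l t.i t.j ≤ l - t.i - t.j := by unfold yy; omega
  obtain ⟨K, hK⟩ : ∃ K, K + 3 * t.q + 2 * t.i = 2 * l + t.j :=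
    ⟨2 * l + t.j - (3 * t.q + 2 * t.i), by omega⟩
  have hw := iter_wordE_PhiTop g4 g5 hp hq hK hu
  obtain ⟨w, hw, -⟩ := exists_iter_of_le (m := m) (by omega) hw
  exact ⟨w, t, ht, _, m, (PhiStart_iff ht).2 hu, hm, hw⟩

lemma PhiString.mem_calG {l : ℕ} {b : AElt} {w : Word} (h : PhiString l b w) : w ∈ calG l := by
  obtain ⟨t, -, u, m, ⟨i, j, p, q, -, -, h1, h2, -, -, h3⟩, -, hw⟩ := h
  have hu := iter_invariant (· ∈ calG l) (fun _ _ => wordF_mem_calG) _ (PhiTop_mem_calG h1 h2) h3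
  exact iter_invariant (· ∈ calG l) (fun _ _ => wordE_mem_calG) _ hu hw

/-- If the strings through `b` and `C_𝒜 b` both start in `B_C`, then `Φ(C_𝒜 b) = C_𝒢 Φ(b)`. -/
lemma PhiString_CA {l : ℕ} {b : AElt} {w w' : Word} (hr : Reduced b) (h : PhiString l b w)
    (h' : PhiString l (CA b) w') : w' = CG w := by
  obtain ⟨t, ht, u, m, hu, hm, hw⟩ := h
  obtain ⟨t', ht', u', m', hu', hm', hw'⟩ := h'
  rw [PhiStart_iff ht] at hu
  rw [PhiStart_iff ht'] at hu'
  have hmem := (mem_BC_union_BR ht).1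
  have hmem' := (mem_BC_union_BR ht').1
  obtain ⟨hb, -, -, hrt⟩ := iter_EA_mem hmem hm
  obtain ⟨-, -, -, hrt'⟩ := iter_EA_mem hmem' hm'
  have hrt := hrt.1 hr
  have hrt' := hrt'.1 ((CA_reduced hb).2 hr)
  obtain ⟨-, hk, hq⟩ := mem_BC.1 (ht.resolve_right fun h => (mem_BR.1 h).2.2.1 hrt)
  obtain ⟨-, hk', hq'⟩ := mem_BC.1 (ht'.resolve_right fun h => (mem_BR.1 h).2.2.1 hrt')
  have hback := iter_EA_CA hmem' hrt' hm'
  rw [CA_CA hb] at hback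
  have hpath : iter (EA l) (m + m') (some t) = some (CA t') := by rw [iter_add, hm, hback]
  obtain ⟨hcase, hrr, hK⟩ := string_between_BC hmem hk hq hmem' hk' hq' hpath
  have hend : iter (wordE i2) (m + m') (some u) = some (CG u') := by
    obtain ⟨g1, g2, g3, g4, g5, g6, g7, g8, g9⟩ := hmem
    obtain ⟨g1', g2', g3', g4', g5', g6', g7', g8', g9'⟩ := hmem'
    exact iter_wordE_PhiTop_eq_CG g4 g5 (by omega) (by omega) g4' (by omega) (by omega) hK
      (by omega) hu hu'
  rw [iter_add, hw] at hend
  -- the `2`-string through `C_𝒢 Φ(t')`, read backwards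
  have hrev : iter (wordE i2) m' (some (CG (CG u'))) = some (CG w) :=
    iter_reverse CG (fun _ => True) (fun _ _ _ _ => trivial)
      (fun x y _ hy => by rw [wordE_CG, (wordE_some hy).1, Option.map_some]) m' trivial hend
  rw [CG_CG, hw'] at hrev
  exact Option.some.inj hrev

lemma PhiCR_spec {l : ℕ} {b : AElt} (hb : b ∈ strCR l) :
    ∃ w, PhiCR l b = some w ∧ PhiString l b w := by
  have h := exists_PhiString hb
  exact ⟨h.choose, by rw [PhiCR, dif_pos h], h.choose_spec⟩

/-- Every element of `𝒜^{(l)}` outside the strings from `B_C ∪ B_R` lies on one of the other two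
kinds of strings, and `C_𝒜` maps it to a string from `B_C ∪ B_R`. -/
lemma cover_of_notMem_strCR {l : ℕ} {b : AElt} (hb : b ∈ calAl l) (hn : b ∉ strCR l) :
    b ∈ strWU l ∪ strR l ∧ CA b ∈ strCR l := by
  obtain ⟨hmem, h⟩ := mem_calAl.1 hb
  have hmem' := CA_mem hmem
  have key : ∀ c ∈ calA l, c.r = 0 → ¬ Reduced c →
      ∃ t ∈ BR l, ∃ m, iter (EA l) m (some t) = some c := by
    intro c hc h0 hr
    obtain ⟨m, t, h1, h2, h3⟩ := exists_start hc h0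
    obtain ⟨-, h5, -, h6⟩ := iter_EA_mem h1 h3
    exact ⟨t, mem_BR.2 ⟨h1, h2, fun h => hr (h6.2 h), h5.symm.trans h0⟩, m, h3⟩
  by_cases hr : Reduced b
  · obtain ⟨m, t, h1, h2, h3, h4, h5, h6⟩ := exists_start_of_reduced hmem hr
    have hq : t.q ≠ t.p := fun hq => hn ⟨t, Or.inl (mem_BC.2 ⟨h1, h3.1, hq⟩), m, h5⟩
    have hle := r_le h1
    refine ⟨Or.inl ⟨setr 0 t, ?_, t.r, m, ?_⟩, ?_⟩
    · exact mem_BW_union_BU (setr_mem h1 (by omega)) h2 h3 hq rfl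
    · rw [iter_f0A _ (by simp only [setr]; omega)]
      simp only [setr, Nat.zero_add]
      exact h5
    · -- since `t` is not in `B_C`, it satisfies `p = j` or `j = i`, and so does `b`
      obtain ⟨m', t', g1, g2, g3, g4, g5, g6⟩ :=
        exists_start_of_reduced hmem' ((CA_reduced hmem).2 hr)
      rw [CA_CA hmem] at g6
      refine ⟨t', Or.inl (mem_BC.2 ⟨g1, g3.1, g6 ?_⟩), m', g5⟩
      have ht : t.p = t.j ∨ t.j = t.i := by
        obtain ⟨i, k, j, p, q, r⟩ := t
        rw [mem_calA] at h1
        simp only [Reduced, IsStart] at h2 h3 hq ⊢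
        omega
      exact iter_EA_edge h1 ht h5
  · have hle := r_le hmem
    rcases h.resolve_left hr with h | h
    · obtain ⟨t, ht, m, hm⟩ := key b hmem h hr
      exact absurd ⟨t, Or.inr ht, m, hm⟩ hn
    · constructor
      · have h0 : setr 0 b ∈ calA l := setr_mem hmem (by omega)
        obtain ⟨t, ht, m, hm⟩ := key (setr 0 b) h0 rfl hr
        obtain ⟨k1, k2, k3, k4⟩ := mem_BR.1 ht
        obtain ⟨-, -, k5, -⟩ := iter_EA_mem k1 hm
        have hle' := r_le k1
        simp only [setr] at k5
        refine Or.inr ⟨t, ht, m, ?_⟩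
        rw [iter_f0A _ (by rw [phi0A]; omega), iter_EA_setr k1 (by rw [phi0A]; omega), hm,
          Option.map_some, show t.r + phi0A t = b.r by rw [phi0A]; omega]
        rfl
      · obtain ⟨t, ht, m, hm⟩ := key (CA b) hmem' (by simp only [CA]; omega)
          (fun h => hr ((CA_reduced hmem).1 h))
        exact ⟨t, Or.inr ht, m, hm⟩

/-- The strings through `b` and `C_𝒜 b` cannot both start in `B_R`. -/
lemma reduced_of_mem_strCR {l : ℕ} {b : AElt} (hb : b ∈ strCR l) (hb' : CA b ∈ strCR l) :
    Reduced b := by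
  obtain ⟨t, ht, m, hm⟩ := hb
  obtain ⟨t', ht', m', hm'⟩ := hb'
  obtain ⟨h1, -, h3, -⟩ := mem_BC_union_BR ht
  obtain ⟨h1', -, h3', -⟩ := mem_BC_union_BR ht'
  obtain ⟨g1, g2, -, g4⟩ := iter_EA_mem h1 hm
  obtain ⟨-, g2', -, g4'⟩ := iter_EA_mem h1' hm'
  by_contra hr
  have e := g2.trans (h3.resolve_left fun h => hr (g4.2 h))
  have e' := g2'.trans (h3'.resolve_left fun h => hr ((CA_reduced g1).1 (g4'.2 h)))
  obtain ⟨i, k, j, p, q, r⟩ := b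
  rw [mem_calA] at g1
  simp only [CA, Reduced] at e e' hr
  omega

lemma Phi_of_mem_calAl {l : ℕ} {b : AElt} (hb : b ∈ calAl l) : Phi l b = PhiLevel l b := by
  cases l with
  | zero => rw [Phi]
  | succ l => rw [Phi, if_pos hb]

end G2Crystal

theorem mainTheorem7 (l : ℕ) (hl : 0 < l) (b : G2Crystal.AElt) (hb : b ∈ G2Crystal.calAl l) :
    ∃ t ∈ G2Crystal.calG l, G2Crystal.Phi l b = some t ∧
      G2Crystal.Phi l (G2Crystal.CA b) = some (G2Crystal.CG t) := by
  open G2Crystal in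
  have hb' := CA_mem_calAl hb
  have hcc := CA_CA (mem_calAl.1 hb).1
  rw [Phi_of_mem_calAl hb, Phi_of_mem_calAl hb', PhiLevel, PhiLevel, hcc]
  by_cases h : b ∈ strCR l
  · obtain ⟨w, hw, hs⟩ := PhiCR_spec h
    refine ⟨w, hs.mem_calG, by rw [if_pos h, hw], ?_⟩
    by_cases h' : CA b ∈ strCR l
    · obtain ⟨w', hw', hs'⟩ := PhiCR_spec h'
      rw [if_pos h', hw', PhiString_CA (reduced_of_mem_strCR h h') hs hs']
    · rw [if_neg h', if_pos (cover_of_notMem_strCR hb' h').1, hw, Option.map_some]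
  · obtain ⟨h1, h2⟩ := cover_of_notMem_strCR hb h
    obtain ⟨w, hw, hs⟩ := PhiCR_spec h2
    refine ⟨CG w, CG_mem_calG hs.mem_calG, ?_, ?_⟩
    · rw [if_neg h, if_pos h1, hw, Option.map_some]
    · rw [if_pos h2, hw, CG_CG]
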